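/- Let $\Omega=(0,1)$, and let $H_0^1(\Omega)$ carry the norm $\|u\|_{H_0^1}=\|u'\|_{L^2(\Omega)}$; its elements are identified with their continuous representatives on $[0,1]$. Let $H_0$ be the multivalued Heaviside function: $H_0(u)=\{-1\}$ for $u<0$, $H_0(0)=[-1,1]$, $H_0(u)=\{1\}$ for $u>0$. Let $(f_\varepsilon)_{0<\varepsilon\le 1}$ be functions $\mathbb R\to\mathbb R$ such that, for each $\varepsilon\in(0,1]$: $f_\varepsilon$ is continuous and non-decreasing; $f_\varepsilon(0)=0$; $f_\varepsilon'(0)>0$ exists and is finite; $f_\varepsilon$ is strictly concave on $(0,\infty)$ and strictly convex on $(-\infty,0)$; $-1<f_\varepsilon(s)<1$ for all $s$; and $|f_\varepsilon(s)-H_0(s)|<\varepsilon$ whenever $|s|>\varepsilon$. Assume moreover that $\varepsilon\mapsto f_\varepsilon'(0)$ is monotone (non-increasing) and that $f_\varepsilon'(0)\to\infty$ as $\varepsilon\to0^+$. A fixed point of the problem $u_t-u_{xx}=f_\varepsilon(u)$ on $\Omega$ with Dirichlet boundary conditions is a $v\in H_0^1(\Omega)$ with $v''+f_\varepsilon(v)=0$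 in $H^{-1}(\Omega)$. A fixed point of the inclusion $u_t-u_{xx}\in H_0(u)$ on $\Omega$ with Dirichlet boundary conditions is a $v\in H^2(\Omega)\cap H_0^1(\Omega)$ for which there is $g\in L^2(\Omega)$ with $-v''=g$ and $g(x)\in H_0(v(x))$ for almost every $x\in\Omega$. For $k\ge1$ we say that $v$ is of type $(k,+)$ (resp. $(k,-)$) if $v$ has exactly $k+1$ zeros $0=x_0<x_1<\dots<x_k=1$ in $[0,1]$ and $(-1)^q v>0$ (resp. $(-1)^q v<0$) on $(x_q,x_{q+1})$ for $q=0,\dots,k-1$. Let $\varepsilon_m\in(0,1]$ be a sequence with $\varepsilon_m\to0$. **Lemma.** For every $k\ge1$ and each choice of sign $\pm$, the inclusion has exactly one fixed point $v_k^\pm$ of type $(k,\pm)$. Moreover, if for all sufficiently large $m$ the function $v_{\varepsilon_m,k}^\pm$ is a fixed point of type $(k,\pm)$ of the problem with $\varepsilon=\varepsilon_m$, then: 1. $v_{\varepsilon_m,k}^\pm$ does not converge to $0$ in $H_0^1(\Omega)$ as $m\to\infty$; 2. $v_{\varepsilon_m,k}^\pm$ converges to $v_k^\pm$ in $H_0^1(\Omega)$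 as $m\to\infty$. -/

import Mathlib

open MeasureTheory Set Filter Topology
open scoped ContDiff

/-- Lebesgue measure on the interval `Ω = (0,1)`. -/
noncomputable abbrev volΩ : Measure ℝ := volume.restrict (Ioo (0 : ℝ) 1)

/-- `φ` is a test function on `(0,1)`: smooth with compact support contained in `(0,1)`. -/
def IsTestFun (φ : ℝ → ℝ) : Prop :=
  ContDiff ℝ ∞ φ ∧ HasCompactSupport φ ∧ tsupport φ ⊆ Ioo 0 1

/-- `g` is a square integrable weak derivative of `u` on `(0,1)`. -/
def IsWeakDeriv (u g : ℝ → ℝ) : Prop :=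
  MemLp g 2 volΩ ∧
    ∀ φ, IsTestFun φ → ∫ x, u x * deriv φ x ∂volΩ = - ∫ x, g x * φ x ∂volΩ

/-- The Sobolev space `H¹(0,1)`. -/
def MemH1 (u : ℝ → ℝ) : Prop :=
  MemLp u 2 volΩ ∧ ∃ g, IsWeakDeriv u g

open Classical in
/-- The weak derivative of a function of `H¹(0,1)` (unique up to null sets of `(0,1)`). -/
noncomputable def weakDeriv (u : ℝ → ℝ) : ℝ → ℝ :=
  if h : ∃ g, IsWeakDeriv u g then h.choose else 0

/-- The space `H¹₀(0,1)`. Its elements are represented by their continuous representative on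
`[0,1]`, which vanishes at both end points; values outside `[0,1]` play no role. -/
def MemH10 (u : ℝ → ℝ) : Prop :=
  MemH1 u ∧ ContinuousOn u (Icc 0 1) ∧ u 0 = 0 ∧ u 1 = 0

/-- The space `H²(0,1)`. -/
def MemH2 (u : ℝ → ℝ) : Prop :=
  MemH1 u ∧ MemH1 (weakDeriv u)

/-- The norm of `H¹₀(0,1)`: the `L²(0,1)` norm of the weak derivative. -/
noncomputable def normH10 (u : ℝ → ℝ) : ℝ :=
  Real.sqrt (∫ x, (weakDeriv u x) ^ 2 ∂volΩ)

/-- The multivalued Heaviside function. -/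
def heavisideSet (s : ℝ) : Set ℝ :=
  {y | (s < 0 → y = -1) ∧ (s = 0 → y ∈ Icc (-1 : ℝ) 1) ∧ (0 < s → y = 1)}

/-- The assumptions on the family of nonlinearities `f ε`, `0 < ε ≤ 1`, that approximate the
Heaviside function. -/
structure IsApproxFamily (f : ℝ → ℝ → ℝ) : Prop where
  continuous : ∀ ε ∈ Ioc (0 : ℝ) 1, Continuous (f ε)
  monotone : ∀ ε ∈ Ioc (0 : ℝ) 1, Monotone (f ε)
  map_zero : ∀ ε ∈ Ioc (0 : ℝ) 1, f ε 0 = 0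
  differentiableAt_zero : ∀ ε ∈ Ioc (0 : ℝ) 1, DifferentiableAt ℝ (f ε) 0
  deriv_zero_pos : ∀ ε ∈ Ioc (0 : ℝ) 1, 0 < deriv (f ε) 0
  deriv_zero_antitone : AntitoneOn (fun ε => deriv (f ε) 0) (Ioc 0 1)
  deriv_zero_tendsto : Tendsto (fun ε => deriv (f ε) 0) (𝓝[>] 0) atTop
  strictConcave : ∀ ε ∈ Ioc (0 : ℝ) 1, StrictConcaveOn ℝ (Ioi 0) (f ε)
  strictConvex : ∀ ε ∈ Ioc (0 : ℝ) 1, StrictConvexOn ℝ (Iio 0) (f ε)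
  bounded : ∀ ε ∈ Ioc (0 : ℝ) 1, ∀ s, -1 < f ε s ∧ f ε s < 1
  close : ∀ ε ∈ Ioc (0 : ℝ) 1, ∀ s, ε < |s| → ∀ y ∈ heavisideSet s, |f ε s - y| < ε

/-- `v` is a fixed point of `u_t - u_xx = g(u)` on `(0,1)` with Dirichlet boundary conditions:
`v ∈ H¹₀(0,1)` and `v'' + g(v) = 0` in `H⁻¹(0,1)`, the dual space of `H¹₀(0,1)`. -/
def IsFixedPointODE (g v : ℝ → ℝ) : Prop :=
  MemH10 v ∧ ∀ φ, MemH10 φ →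
    ∫ x, weakDeriv v x * weakDeriv φ x ∂volΩ = ∫ x, g (v x) * φ x ∂volΩ

/-- `v` is a fixed point of the inclusion `u_t - u_xx ∈ H₀(u)` on `(0,1)` with Dirichlet boundary
conditions, that is, a stationary strong solution: `v ∈ H²(0,1) ∩ H¹₀(0,1)` and there is
`g ∈ L²(0,1)` with `g(x) ∈ H₀(v(x))` and `-v''(x) = g(x)` for almost every `x`. -/
def IsFixedPointHeaviside (v : ℝ → ℝ) : Prop :=
  MemH2 v ∧ MemH10 v ∧ ∃ g : ℝ → ℝ, MemLp g 2 volΩ ∧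
    (∀ᵐ x ∂volΩ, g x ∈ heavisideSet (v x)) ∧
    (∀ᵐ x ∂volΩ, - weakDeriv (weakDeriv v) x = g x)

/-- `v` has exactly `k + 1` zeros `0 = x₀ < x₁ < ⋯ < x_k = 1` in `[0,1]`, and `σ (-1)^q v > 0` on
`(x_q, x_{q+1})` for `0 ≤ q < k`. The sign `σ = 1` belongs to the superscript `+` and `σ = -1` to
the superscript `-`. -/
def HasNodalPattern (σ : ℝ) (k : ℕ) (v : ℝ → ℝ) : Prop :=
  ∃ x : ℕ → ℝ, x 0 = 0 ∧ x k = 1 ∧ (∀ q < k, x q < x (q + 1)) ∧ (∀ q ≤ k, v (x q) = 0) ∧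
    ∀ q < k, ∀ y ∈ Ioo (x q) (x (q + 1)), 0 < σ * (-1) ^ q * v y

/-! ### Sobolev functions on the unit interval -/

/-! For the inclusion, `v` is a parabola with `v'' = -s` on every nodal interval of sign `s`.
Vanishing at both ends makes its end slopes `±s/2` times the length of the interval. Since `v'` is
continuous, adjacent intervals have equal length, so the nodes are `q/k` and `v` is determined
(`eqOn_nodalProfile`). Conversely, these parabolas glue to a fixed point.

For the regularized problem, reflect each nodal interval `[a,b]` so that the solution is positive.
It then solves `v'' + g(v) = 0` with `g` nondecreasing and concave on `[0,∞)`, at most `1`, and at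
least `1 - e` beyond `e`. Conservation of energy gives `v'(b) = -v'(a)`, so all nodal slopes have
the same modulus `P`. From `g ≤ 1`, the length of the interval is at least `2P`. Concavity of `v`
confines the region `v < e` to a small part of the interval, so the length is at most `2P + e(1 +
2/P²)` (`IsBump.length_le`). The same error controls the distance of `v'` from the slope of a
parabola (`IsBump.deriv_bounds`).

The error tends to zero only if `P` stays away from zero. This is `IsBump.le_slope`: some interval
has length at least `1/k`, and concavity of `g` keeps a solution on it from being small. This also
excludes convergence to `0`. Since the lengths add up to `1`, `P → 1/(2k)`, the nodes tend to `q/k`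
and the derivatives converge off the grid. They are uniformly bounded, so dominated convergence
gives convergence in `L²`, that is, in the norm of `H¹₀`. -/

theorem integral_volΩ_eq (F : ℝ → ℝ) : ∫ x, F x ∂volΩ = ∫ x in (0 : ℝ)..1, F x := by
  rw [intervalIntegral.integral_of_le zero_le_one, integral_Ioc_eq_integral_Ioo]

theorem MeasureTheory.Integrable.intervalIntegrable_unit {g : ℝ → ℝ} (hg : Integrable g volΩ) :
    IntervalIntegrable g volume 0 1 := by
  rw [intervalIntegrable_iff_integrableOn_Ioo_of_le zero_le_one]
  exact hg

theorem MeasureTheory.MemLp.integrable_volΩ {g : ℝ → ℝ} (hg : MemLp g 2 volΩ) :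
    Integrable g volΩ :=
  hg.integrable (by norm_num)

theorem MeasureTheory.MemLp.integrable_mul_volΩ {g h : ℝ → ℝ} (hg : MemLp g 2 volΩ)
    (hh : MemLp h 2 volΩ) : Integrable (fun x => g x * h x) volΩ :=
  hg.integrable_mul hh

theorem IsTestFun.exists_subset_Icc {φ : ℝ → ℝ} (h : IsTestFun φ) :
    ∃ a b, 0 < a ∧ a < b ∧ b < 1 ∧ ∀ x, x ∉ Icc a b → φ x = 0 := by
  obtain ⟨-, hc, hs⟩ := h
  rcases (tsupport φ).eq_empty_or_nonempty with he | hne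
  · refine ⟨1 / 4, 1 / 2, by norm_num, by norm_num, by norm_num, fun x _ => ?_⟩
    exact image_eq_zero_of_notMem_tsupport (by simp [he])
  · obtain ⟨a, ha, hamin⟩ := hc.exists_isMinOn hne continuousOn_id
    obtain ⟨b, hb, hbmax⟩ := hc.exists_isMaxOn hne continuousOn_id
    have ha' := hs ha
    have hb' := hs hb
    have hab : a ≤ b := hamin hb
    -- Only `a ≤ b` is known here; moving the right end halfway to `1` makes the interval
    -- nondegenerate.
    refine ⟨a, (b + 1) / 2, ha'.1, by linarith [hb'.2], by linarith [hb'.2], fun x hx => ?_⟩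
    refine image_eq_zero_of_notMem_tsupport fun hxs => hx ⟨hamin hxs, ?_⟩
    have : x ≤ b := hbmax hxs
    linarith [hb'.2]

theorem isTestFun_of_subset_Icc {φ : ℝ → ℝ} (hφ : ContDiff ℝ ∞ φ) {a b : ℝ} (ha : 0 < a)
    (hb : b < 1) (h : ∀ x, x ∉ Icc a b → φ x = 0) : IsTestFun φ := by
  have hsub : tsupport φ ⊆ Icc a b :=
    closure_minimal (fun x hx => by_contra fun hn => hx (h x hn)) isClosed_Icc
  exact ⟨hφ, HasCompactSupport.of_support_subset_isCompact isCompact_Icc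
    (subset_closure.trans hsub), hsub.trans fun x hx => ⟨ha.trans_le hx.1, hx.2.trans_lt hb⟩⟩

theorem ae_eq_zero_of_integral_testFun {h : ℝ → ℝ} (hh : Integrable h volΩ)
    (h0 : ∀ φ, IsTestFun φ → ∫ x, h x * φ x ∂volΩ = 0) : h =ᵐ[volΩ] 0 := by
  have := isOpen_Ioo.ae_eq_zero_of_integral_contDiff_smul_eq_zero
    (μ := volume) (U := Ioo (0 : ℝ) 1) (f := h) (IntegrableOn.locallyIntegrableOn hh)
    (fun φ h1 h2 h3 => by
      have := h0 φ ⟨h1, h2, h3⟩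
      rw [← this, ← setIntegral_eq_integral_of_forall_compl_eq_zero (s := Ioo (0 : ℝ) 1)]
      · simp [mul_comm]
      · intro x hx
        rw [image_eq_zero_of_notMem_tsupport fun hx' => hx (h3 hx'), zero_smul])
  rw [EventuallyEq, ae_restrict_iff' measurableSet_Ioo]
  exact this

theorem IsTestFun.memLp {φ : ℝ → ℝ} (h : IsTestFun φ) : MemLp φ 2 volΩ :=
  (h.1.continuous.memLp_of_hasCompactSupport h.2.1).restrict _

theorem IsWeakDeriv.ae_eq {u g g' : ℝ → ℝ} (h : IsWeakDeriv u g) (h' : IsWeakDeriv u g') :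
    g =ᵐ[volΩ] g' := by
  have := ae_eq_zero_of_integral_testFun (h := fun x => g x - g' x)
    (h.1.integrable_volΩ.sub h'.1.integrable_volΩ) fun φ hφ => by
      have e1 := h.2 φ hφ
      have e2 := h'.2 φ hφ
      simp_rw [sub_mul]
      rw [integral_sub (h.1.integrable_mul_volΩ hφ.memLp) (h'.1.integrable_mul_volΩ hφ.memLp)]
      linarith
  filter_upwards [this] with x hx
  simpa [sub_eq_zero] using hx

theorem isWeakDeriv_weakDeriv {u : ℝ → ℝ} (h : ∃ g, IsWeakDeriv u g) :
    IsWeakDeriv u (weakDeriv u) := by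
  rw [weakDeriv, dif_pos h]
  exact h.choose_spec

theorem IsWeakDeriv.weakDeriv_ae_eq {u g : ℝ → ℝ} (h : IsWeakDeriv u g) :
    weakDeriv u =ᵐ[volΩ] g :=
  (isWeakDeriv_weakDeriv ⟨g, h⟩).ae_eq h

theorem IsWeakDeriv.congr_left {u u' g : ℝ → ℝ} (h : IsWeakDeriv u g) (hu : u =ᵐ[volΩ] u') :
    IsWeakDeriv u' g := by
  refine ⟨h.1, fun φ hφ => ?_⟩
  rw [← h.2 φ hφ]
  refine integral_congr_ae ?_
  filter_upwards [hu] with x hx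
  rw [hx]

theorem IsWeakDeriv.congr_right {u g g' : ℝ → ℝ} (h : IsWeakDeriv u g) (hg : g =ᵐ[volΩ] g') :
    IsWeakDeriv u g' := by
  refine ⟨(memLp_congr_ae hg).1 h.1, fun φ hφ => ?_⟩
  rw [h.2 φ hφ]
  congr 1
  refine integral_congr_ae ?_
  filter_upwards [hg] with x hx
  rw [hx]

theorem IsTestFun.deriv_memLp {φ : ℝ → ℝ} (h : IsTestFun φ) : MemLp (deriv φ) 2 volΩ :=
  ((h.1.continuous_deriv (by simp)).memLp_of_hasCompactSupport h.2.1.deriv).restrict _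

theorem IsWeakDeriv.sub {u u' g g' : ℝ → ℝ} (hu : MemLp u 2 volΩ) (hu' : MemLp u' 2 volΩ)
    (h : IsWeakDeriv u g) (h' : IsWeakDeriv u' g') :
    IsWeakDeriv (u - u') (g - g') := by
  refine ⟨h.1.sub h'.1, fun φ hφ => ?_⟩
  simp only [Pi.sub_apply, sub_mul]
  rw [integral_sub (hu.integrable_mul_volΩ hφ.deriv_memLp) (hu'.integrable_mul_volΩ hφ.deriv_memLp),
    integral_sub (h.1.integrable_mul_volΩ hφ.memLp) (h'.1.integrable_mul_volΩ hφ.memLp),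
    h.2 φ hφ, h'.2 φ hφ]
  ring

theorem absolutelyContinuous_primitive {g : ℝ → ℝ} (hg : Integrable g volΩ) :
    AbsolutelyContinuousOnInterval (fun x => ∫ t in (0 : ℝ)..x, g t) 0 1 :=
  hg.intervalIntegrable_unit.absolutelyContinuousOnInterval_intervalIntegral (by simp)

theorem continuousOn_primitive {g : ℝ → ℝ} (hg : Integrable g volΩ) :
    ContinuousOn (fun x => ∫ t in (0 : ℝ)..x, g t) (Icc 0 1) := by
  simpa using (absolutelyContinuous_primitive hg).continuousOn

theorem memLp_of_continuousOn {u : ℝ → ℝ} (hu : ContinuousOn u (Icc 0 1)) : MemLp u 2 volΩ := by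
  obtain ⟨C, hC⟩ := isCompact_Icc.exists_bound_of_continuousOn hu
  refine MemLp.of_bound
    ((hu.mono Ioo_subset_Icc_self).aestronglyMeasurable measurableSet_Ioo) C ?_
  exact (ae_restrict_iff' measurableSet_Ioo).2
    (Eventually.of_forall fun x hx => hC x (Ioo_subset_Icc_self hx))

/-- Integration by parts for absolutely continuous functions, so that `g` need only be integrable;
the boundary terms vanish with `φ`. -/
theorem integral_primitive_mul_deriv {g φ : ℝ → ℝ} (hg : Integrable g volΩ) (hφ : IsTestFun φ)
    (c : ℝ) :
    ∫ x, (c + ∫ t in (0 : ℝ)..x, g t) * deriv φ x ∂volΩ = - ∫ x, g x * φ x ∂volΩ := by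
  have hac : AbsolutelyContinuousOnInterval (fun x => ∫ t in (0 : ℝ)..x, g t) 0 1 :=
    absolutelyContinuous_primitive hg
  have hφac : AbsolutelyContinuousOnInterval φ 0 1 :=
    (hφ.1.of_le (by simp)).contDiffOn.absolutelyContinuousOnInterval
  have h0 : φ 0 = 0 := image_eq_zero_of_notMem_tsupport fun h => lt_irrefl _ (hφ.2.2 h).1
  have h1 : φ 1 = 0 := image_eq_zero_of_notMem_tsupport fun h => lt_irrefl _ (hφ.2.2 h).2
  have hibp := hac.integral_mul_deriv_eq_deriv_mul hφac
  have hdφ : ∫ x in (0 : ℝ)..1, deriv φ x = 0 := by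
    rw [hφac.integral_deriv_eq_sub, h0, h1, sub_zero]
  have hI : IntervalIntegrable (deriv φ) volume 0 1 :=
    (hφ.1.continuous_deriv (by simp)).intervalIntegrable _ _
  rw [integral_volΩ_eq, integral_volΩ_eq]
  simp_rw [add_mul]
  rw [intervalIntegral.integral_add (hI.const_mul c)
      (hI.continuousOn_mul hac.continuousOn), intervalIntegral.integral_const_mul, hdφ, hibp,
    h0, h1]
  have : ∫ x in (0 : ℝ)..1, deriv (fun x => ∫ t in (0 : ℝ)..x, g t) x * φ x
      = ∫ x in (0 : ℝ)..1, g x * φ x := by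
    refine intervalIntegral.integral_congr_ae ?_
    filter_upwards [hg.intervalIntegrable_unit.ae_hasDerivAt_integral] with x hx hx'
    rw [(hx (uIoc_subset_uIcc hx') 0 (by simp)).deriv]
  rw [this]
  ring

theorem isWeakDeriv_of_primitive {u g : ℝ → ℝ} (hg : MemLp g 2 volΩ) {c : ℝ}
    (hu : ∀ x ∈ Ioo (0 : ℝ) 1, u x = c + ∫ t in (0 : ℝ)..x, g t) : IsWeakDeriv u g := by
  refine ⟨hg, fun φ hφ => ?_⟩
  rw [← integral_primitive_mul_deriv hg.integrable_volΩ hφ c]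
  refine integral_congr_ae ?_
  filter_upwards [ae_restrict_mem measurableSet_Ioo] with x hx
  rw [hu x hx]

/-- The du Bois-Reymond lemma. -/
theorem exists_const_of_integral_mul_deriv_eq_zero {h : ℝ → ℝ} (hh : MemLp h 2 volΩ)
    (h0 : ∀ φ, IsTestFun φ → ∫ x, h x * deriv φ x ∂volΩ = 0) :
    ∃ c : ℝ, h =ᵐ[volΩ] fun _ => c := by
  let B : ContDiffBump (1 / 2 : ℝ) := ⟨1 / 8, 1 / 4, by norm_num, by norm_num⟩
  let ψ : ℝ → ℝ := B.normed volume
  have hψc : ContDiff ℝ ∞ ψ := B.contDiff_normed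
  have hψs : ∀ x, x ∉ Icc (1 / 4 : ℝ) (3 / 4) → ψ x = 0 := by
    intro x hx
    refine Function.notMem_support.1 fun hx' => hx ?_
    rw [B.support_normed_eq, Real.ball_eq_Ioo] at hx'
    have h1 := hx'.1
    have h2 := hx'.2
    simp only [B] at h1 h2
    constructor <;> linarith
  have hψt : IsTestFun ψ := isTestFun_of_subset_Icc hψc (by norm_num) (by norm_num) hψs
  refine ⟨∫ x, h x * ψ x ∂volΩ, ?_⟩
  set c := ∫ x, h x * ψ x ∂volΩ with hc
  have key := ae_eq_zero_of_integral_testFun (h := fun x => h x - c)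
    (hh.integrable_volΩ.sub (integrable_const c)) fun φ hφ => by
      obtain ⟨a, b, ha, hab, hb, hφs⟩ := hφ.exists_subset_Icc
      set I := ∫ x in (0 : ℝ)..1, φ x with hI
      -- Subtracting the mean along the fixed bump `ψ` leaves a function of integral zero. Its
      -- primitive `Θ` therefore has compact support in `(0,1)` and is an admissible test function.
      let θ : ℝ → ℝ := fun x => φ x - I * ψ x
      have hθc : ContDiff ℝ ∞ θ := hφ.1.sub (contDiff_const.mul hψc)
      let a' := min a (1 / 4)
      let b' := max b (3 / 4)
      have ha' : 0 < a' := by positivity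
      have hb' : b' < 1 := max_lt hb (by norm_num)
      have hθs : ∀ x, x ∉ Icc a' b' → θ x = 0 := by
        intro x hx
        have e1 : φ x = 0 := hφs x fun hx' =>
          hx ⟨(min_le_left _ _).trans hx'.1, hx'.2.trans (le_max_left _ _)⟩
        have e2 : ψ x = 0 := hψs x fun hx' =>
          hx ⟨(min_le_right _ _).trans hx'.1, hx'.2.trans (le_max_right _ _)⟩
        simp [θ, e1, e2]
      have hψ1 : ∫ x in (0 : ℝ)..1, ψ x = 1 := by
        rw [← integral_volΩ_eq, setIntegral_eq_integral_of_forall_compl_eq_zero,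
          B.integral_normed]
        intro x hx
        exact image_eq_zero_of_notMem_tsupport fun h => hx (hψt.2.2 h)
      have hθ1 : ∫ x in (0 : ℝ)..1, θ x = 0 := by
        rw [intervalIntegral.integral_sub (hφ.1.continuous.intervalIntegrable _ _)
          ((hψc.continuous.intervalIntegrable _ _).const_mul I),
          intervalIntegral.integral_const_mul, hψ1]
        simp [hI]
      let Θ : ℝ → ℝ := fun x => ∫ t in (0 : ℝ)..x, θ t
      have hΘd : ∀ x, HasDerivAt Θ (θ x) x := fun x =>
        intervalIntegral.integral_hasDerivAt_right (hθc.continuous.intervalIntegrable _ _)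
          (hθc.continuous.stronglyMeasurableAtFilter _ _) hθc.continuous.continuousAt
      have hΘd' : deriv Θ = θ := funext fun x => (hΘd x).deriv
      have hΘc : ContDiff ℝ ∞ Θ := by
        rw [contDiff_infty_iff_deriv, hΘd']
        exact ⟨fun x => (hΘd x).differentiableAt, hθc⟩
      have hΘs : ∀ x, x ∉ Icc a' b' → Θ x = 0 := by
        intro x hx
        by_cases hxa : x < a'
        · refine (intervalIntegral.integral_congr (g := fun _ => (0 : ℝ)) fun t ht => ?_).trans
            (by simp)
          refine hθs t fun ht' => ?_
          rcases le_total 0 x with h | h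
          · rw [uIcc_of_le h] at ht
            linarith [ht.2, ht'.1]
          · rw [uIcc_of_ge h] at ht
            linarith [ht.2, ht'.1]
        · have hxb : b' < x := by
            by_contra hn
            exact hx ⟨not_lt.1 hxa, not_lt.1 hn⟩
          have : Θ x = Θ 1 + ∫ t in (1 : ℝ)..x, θ t :=
            (intervalIntegral.integral_add_adjacent_intervals
              (hθc.continuous.intervalIntegrable _ _)
              (hθc.continuous.intervalIntegrable _ _)).symm
          rw [this, show Θ 1 = 0 from hθ1, zero_add]
          refine (intervalIntegral.integral_congr (g := fun _ => (0 : ℝ)) fun t ht => ?_).trans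
            (by simp)
          refine hθs t fun ht' => ?_
          rcases le_total 1 x with h | h
          · rw [uIcc_of_le h] at ht
            linarith [ht.1, ht'.2]
          · rw [uIcc_of_ge h] at ht
            linarith [ht.1, ht'.2]
      have hΘ := h0 Θ (isTestFun_of_subset_Icc hΘc ha' hb' hΘs)
      rw [hΘd'] at hΘ
      have e : ∫ x, h x * θ x ∂volΩ = ∫ x, h x * φ x ∂volΩ - I * c := by
        rw [hc, ← integral_const_mul, ← integral_sub (hh.integrable_mul_volΩ hφ.memLp)
          ((hh.integrable_mul_volΩ hψt.memLp).const_mul I)]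
        refine integral_congr_ae (Eventually.of_forall fun x => ?_)
        simp only [θ]
        ring
      simp_rw [sub_mul]
      rw [integral_sub (hh.integrable_mul_volΩ hφ.memLp) (hφ.memLp.integrable_volΩ.const_mul c),
        integral_const_mul, integral_volΩ_eq φ, ← hI]
      linarith
  filter_upwards [key] with x hx
  simpa [sub_eq_zero] using hx

/-- The difference of `u` and the primitive of `g` has weak derivative zero, so the du Bois-Reymond
lemma applies. -/
theorem IsWeakDeriv.exists_ae_eq_primitive {u g : ℝ → ℝ} (hu : MemLp u 2 volΩ)
    (h : IsWeakDeriv u g) :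
    ∃ c : ℝ, u =ᵐ[volΩ] fun x => c + ∫ t in (0 : ℝ)..x, g t := by
  have hP : MemLp (fun x => ∫ t in (0 : ℝ)..x, g t) 2 volΩ :=
    memLp_of_continuousOn (continuousOn_primitive h.1.integrable_volΩ)
  obtain ⟨c, hc⟩ := exists_const_of_integral_mul_deriv_eq_zero (hu.sub hP) fun φ hφ => by
    have e := integral_primitive_mul_deriv h.1.integrable_volΩ hφ 0
    simp only [zero_add] at e
    simp only [Pi.sub_apply, sub_mul]
    rw [integral_sub (hu.integrable_mul_volΩ hφ.deriv_memLp) (hP.integrable_mul_volΩ hφ.deriv_memLp),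
      h.2 φ hφ, e, sub_self]
  refine ⟨c, ?_⟩
  filter_upwards [hc] with x hx
  simp only [Pi.sub_apply] at hx
  linarith

theorem eqOn_Icc_of_ae_eq {u v : ℝ → ℝ} (hu : ContinuousOn u (Icc 0 1))
    (hv : ContinuousOn v (Icc 0 1)) (h : u =ᵐ[volΩ] v) : EqOn u v (Icc 0 1) := by
  have h1 : EqOn u v (Ioo 0 1) :=
    Measure.eqOn_open_of_ae_eq h isOpen_Ioo (hu.mono Ioo_subset_Icc_self)
      (hv.mono Ioo_subset_Icc_self)
  refine h1.of_subset_closure hu hv Ioo_subset_Icc_self ?_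
  rw [closure_Ioo zero_ne_one]

theorem primitive_congr {g p : ℝ → ℝ} (h : g =ᵐ[volΩ] p) {x : ℝ} (hx : x ∈ Icc (0 : ℝ) 1) :
    ∫ t in (0 : ℝ)..x, g t = ∫ t in (0 : ℝ)..x, p t := by
  rw [intervalIntegral.integral_of_le hx.1, intervalIntegral.integral_of_le hx.1,
    integral_Ioc_eq_integral_Ioo, integral_Ioc_eq_integral_Ioo]
  exact integral_congr_ae (ae_mono (Measure.restrict_mono (Ioo_subset_Ioo_right hx.2) le_rfl) h)

theorem MemH10.eq_primitive {u p : ℝ → ℝ} (hu : MemH10 u) (hp : IsWeakDeriv u p) :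
    ∀ x ∈ Icc (0 : ℝ) 1, u x = ∫ t in (0 : ℝ)..x, p t := by
  obtain ⟨c, hc⟩ := hp.exists_ae_eq_primitive hu.1.1
  have h : EqOn u (fun x => c + ∫ t in (0 : ℝ)..x, p t) (Icc 0 1) := eqOn_Icc_of_ae_eq hu.2.1
    (continuousOn_const.add (continuousOn_primitive hp.1.integrable_volΩ)) hc
  have h0 := h (left_mem_Icc.2 zero_le_one)
  simp only [hu.2.2.1, intervalIntegral.integral_same, add_zero] at h0
  intro x hx
  rw [h hx]
  simp [← h0]

theorem IsTestFun.isWeakDeriv {φ : ℝ → ℝ} (h : IsTestFun φ) : IsWeakDeriv φ (deriv φ) := by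
  refine isWeakDeriv_of_primitive (c := φ 0) h.deriv_memLp fun x _ => ?_
  rw [intervalIntegral.integral_deriv_eq_sub
    (fun y _ => (h.1.differentiable (by simp)).differentiableAt)
    ((h.1.continuous_deriv (by simp)).intervalIntegrable _ _)]
  ring

theorem IsTestFun.memH10 {φ : ℝ → ℝ} (h : IsTestFun φ) : MemH10 φ :=
  ⟨⟨h.memLp, _, h.isWeakDeriv⟩, h.1.continuous.continuousOn,
    image_eq_zero_of_notMem_tsupport fun h' => lt_irrefl _ (h.2.2 h').1,
    image_eq_zero_of_notMem_tsupport fun h' => lt_irrefl _ (h.2.2 h').2⟩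

theorem normH10_eq {u p : ℝ → ℝ} (h : IsWeakDeriv u p) :
    normH10 u = Real.sqrt (∫ x, p x ^ 2 ∂volΩ) := by
  rw [normH10]
  congr 1
  refine integral_congr_ae ?_
  filter_upwards [h.weakDeriv_ae_eq] with x hx
  rw [hx]

/-! ### One bump of a solution of `v'' + g(v) = 0` -/

theorem sub_le_mul_of_hasDerivAt_le {F F' : ℝ → ℝ} {x y C : ℝ} (hxy : x ≤ y)
    (hc : ContinuousOn F (Icc x y)) (hd : ∀ z ∈ Ioo x y, HasDerivAt F (F' z) z)
    (hC : ∀ z ∈ Ioo x y, F' z ≤ C) : F y - F x ≤ C * (y - x) := by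
  rcases hxy.eq_or_lt with rfl | hlt
  · simp
  · obtain ⟨z, hz, he⟩ := exists_hasDerivAt_eq_slope F F' hlt hc hd
    have := hC z hz
    rw [he, div_le_iff₀ (sub_pos.2 hlt)] at this
    exact this

theorem mul_le_sub_of_le_hasDerivAt {F F' : ℝ → ℝ} {x y C : ℝ} (hxy : x ≤ y)
    (hc : ContinuousOn F (Icc x y)) (hd : ∀ z ∈ Ioo x y, HasDerivAt F (F' z) z)
    (hC : ∀ z ∈ Ioo x y, C ≤ F' z) : C * (y - x) ≤ F y - F x := by
  rcases hxy.eq_or_lt with rfl | hlt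
  · simp
  · obtain ⟨z, hz, he⟩ := exists_hasDerivAt_eq_slope F F' hlt hc hd
    have := hC z hz
    rw [he, le_div_iff₀ (sub_pos.2 hlt)] at this
    exact this

/-- On `[0,∞)` the function `g` is an approximation from below of the constant `1`, up to the
error `e` beyond the point `e`. -/
structure IsUnitApprox (g : ℝ → ℝ) (e : ℝ) : Prop where
  pos : 0 < e
  continuous : Continuous g
  monotone : Monotone g
  map_zero : g 0 = 0
  le_one : ∀ s, g s ≤ 1
  concaveOn : ConcaveOn ℝ (Ici 0) g
  close : ∀ s, e ≤ s → 1 - e ≤ g s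

/-- `v` solves `v'' + g(v) = 0` on `(a,b)` with `v' = p`, is positive on `(a,b)` and vanishes at
the end points. -/
structure IsBump (g v p : ℝ → ℝ) (a b : ℝ) : Prop where
  lt : a < b
  continuousOn : ContinuousOn v (Icc a b)
  continuousOn_deriv : ContinuousOn p (Icc a b)
  hasDerivAt : ∀ x ∈ Ioo a b, HasDerivAt v (p x) x
  hasDerivAt_deriv : ∀ x ∈ Ioo a b, HasDerivAt p (-g (v x)) x
  left : v a = 0
  right : v b = 0
  pos : ∀ x ∈ Ioo a b, 0 < v x

namespace IsBump

variable {g v p : ℝ → ℝ} {a b e : ℝ}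

theorem map_nonneg (hg : IsUnitApprox g e) {s : ℝ} (hs : 0 ≤ s) : 0 ≤ g s :=
  hg.map_zero ▸ hg.monotone hs

theorem antitoneOn_deriv (h : IsBump g v p a b) (hg : IsUnitApprox g e) :
    AntitoneOn p (Icc a b) := by
  intro x hx y hy hxy
  have := sub_le_mul_of_hasDerivAt_le (C := 0) hxy
    (h.continuousOn_deriv.mono (Icc_subset_Icc hx.1 hy.2))
    (fun z hz => h.hasDerivAt_deriv z ⟨hx.1.trans_lt hz.1, hz.2.trans_le hy.2⟩)
    (fun z hz => neg_nonpos.2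
      (map_nonneg hg (h.pos z ⟨hx.1.trans_lt hz.1, hz.2.trans_le hy.2⟩).le))
  linarith

theorem concaveOn (h : IsBump g v p a b) (hg : IsUnitApprox g e) : ConcaveOn ℝ (Icc a b) v := by
  refine AntitoneOn.concaveOn_of_deriv (convex_Icc a b) h.continuousOn ?_ ?_
  · rw [interior_Icc]
    exact fun x hx => (h.hasDerivAt x hx).differentiableAt.differentiableWithinAt
  · rw [interior_Icc]
    intro x hx y hy hxy
    rw [(h.hasDerivAt x hx).deriv, (h.hasDerivAt y hy).deriv]
    exact h.antitoneOn_deriv hg (Ioo_subset_Icc_self hx) (Ioo_subset_Icc_self hy) hxy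

theorem exists_peak (h : IsBump g v p a b) : ∃ c ∈ Ioo a b, p c = 0 := by
  obtain ⟨c, hc, hmax⟩ := exists_hasDerivAt_eq_zero h.lt h.continuousOn
    (h.left.trans h.right.symm) h.hasDerivAt
  exact ⟨c, hc, hmax⟩

/-- By concavity `v` lies above the tent with feet `a`, `b` and apex `(c, v c)`. This locates where
`v` is large enough for lower bounds on `g`. -/
theorem mul_le (h : IsBump g v p a b) (hg : IsUnitApprox g e) {c : ℝ} (hc : c ∈ Ioo a b)
    {θ z : ℝ} (hθ : 0 ≤ θ) (hz : z ∈ Icc (a + θ * (c - a)) (b - θ * (b - c))) :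
    θ * v c ≤ v z := by
  have hca : 0 < c - a := sub_pos.2 hc.1
  have hbc : 0 < b - c := sub_pos.2 hc.2
  have hM := h.pos c hc
  have hcc := Ioo_subset_Icc_self hc
  have h1 := mul_nonneg hθ hca.le
  have h2 := mul_nonneg hθ hbc.le
  rcases le_total z c with hzc | hzc
  · have ht : θ ≤ (z - a) / (c - a) := by
      rw [le_div_iff₀ hca]
      linarith [hz.1]
    have ht1 : (z - a) / (c - a) ≤ 1 := by
      rw [div_le_one hca]
      linarith
    have := (h.concaveOn hg).2 (left_mem_Icc.2 h.lt.le) hcc (sub_nonneg.2 ht1) (hθ.trans ht)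
      (by ring)
    have e1 : (1 - (z - a) / (c - a)) • a + ((z - a) / (c - a)) • c = z := by
      simp only [smul_eq_mul]
      field_simp
      ring
    rw [e1, h.left, smul_zero, zero_add, smul_eq_mul] at this
    exact (mul_le_mul_of_nonneg_right ht hM.le).trans this
  · have ht : θ ≤ (b - z) / (b - c) := by
      rw [le_div_iff₀ hbc]
      linarith [hz.2]
    have ht1 : (b - z) / (b - c) ≤ 1 := by
      rw [div_le_one hbc]
      linarith
    have := (h.concaveOn hg).2 (right_mem_Icc.2 h.lt.le) hcc (sub_nonneg.2 ht1) (hθ.trans ht)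
      (by ring)
    have e1 : (1 - (b - z) / (b - c)) • b + ((b - z) / (b - c)) • c = z := by
      simp only [smul_eq_mul]
      field_simp
      ring
    rw [e1, h.right, smul_zero, zero_add, smul_eq_mul] at this
    exact (mul_le_mul_of_nonneg_right ht hM.le).trans this

/-- Conservation of energy. -/
theorem energy (h : IsBump g v p a b) (hg : Continuous g) {x : ℝ} (hx : x ∈ Icc a b) :
    p x ^ 2 / 2 + ∫ s in (0 : ℝ)..v x, g s = p a ^ 2 / 2 := by
  have hF : ∀ s, HasDerivAt (fun r => ∫ s in (0 : ℝ)..r, g s) (g s) s := fun s =>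
    intervalIntegral.integral_hasDerivAt_right (hg.intervalIntegrable _ _)
      (hg.stronglyMeasurableAtFilter _ _) hg.continuousAt
  have hFc : Continuous fun r => ∫ s in (0 : ℝ)..r, g s :=
    continuous_iff_continuousAt.2 fun s => (hF s).continuousAt
  have hE : ∀ z ∈ Ioo a b,
      HasDerivAt (fun x => p x ^ 2 / 2 + ∫ s in (0 : ℝ)..v x, g s) 0 z := fun z hz => by
    have h1 := ((h.hasDerivAt_deriv z hz).pow 2).div_const 2
    have h2 := (hF (v z)).comp z (h.hasDerivAt z hz)
    refine (h1.add h2).congr_deriv ?_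
    simp only [Nat.cast_ofNat]
    ring
  have hc : ContinuousOn (fun x => p x ^ 2 / 2 + ∫ s in (0 : ℝ)..v x, g s) (Icc a x) :=
    (((h.continuousOn_deriv.pow 2).div_const 2).add
      (hFc.comp_continuousOn h.continuousOn)).mono (Icc_subset_Icc_right hx.2)
  have hE' : ∀ z ∈ Ioo a x,
      HasDerivAt (fun x => p x ^ 2 / 2 + ∫ s in (0 : ℝ)..v x, g s) 0 z :=
    fun z hz => hE z ⟨hz.1, hz.2.trans_le hx.2⟩
  have u1 := sub_le_mul_of_hasDerivAt_le (F' := fun _ => 0) hx.1 hc hE' (fun _ _ => le_rfl)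
  have u2 := mul_le_sub_of_le_hasDerivAt (F' := fun _ => 0) hx.1 hc hE' (fun _ _ => le_rfl)
  simp only [h.left, intervalIntegral.integral_same, add_zero, zero_mul] at u1 u2
  linarith

/-- Compare the energy at the left end with that at the peak, and bound the potential by
monotonicity of `g`. -/
theorem sq_le (h : IsBump g v p a b) (hg : IsUnitApprox g e) {c : ℝ} (hc : c ∈ Ioo a b)
    (hpc : p c = 0) : p a ^ 2 ≤ 2 * (v c * g (v c)) := by
  have he := h.energy hg.continuous (Ioo_subset_Icc_self hc)
  have hM := (h.pos c hc).le
  have : ∫ s in (0 : ℝ)..v c, g s ≤ ∫ _ in (0 : ℝ)..v c, g (v c) :=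
    intervalIntegral.integral_mono_on hM (hg.continuous.intervalIntegrable _ _)
      (by simp) fun s hs => hg.monotone hs.2
  simp only [intervalIntegral.integral_const, smul_eq_mul, sub_zero] at this
  rw [hpc] at he
  linarith

/-- The potential vanishes at both ends, so the slopes agree up to sign; `p` decreases through zero
at the peak, which fixes the sign. -/
theorem right_eq_neg (h : IsBump g v p a b) (hg : IsUnitApprox g e) : p b = -p a := by
  obtain ⟨c, hc, hpc⟩ := h.exists_peak
  have he := h.energy hg.continuous (right_mem_Icc.2 h.lt.le)
  rw [h.right, intervalIntegral.integral_same, add_zero] at he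
  have h1 := h.antitoneOn_deriv hg (left_mem_Icc.2 h.lt.le) (Ioo_subset_Icc_self hc) hc.1.le
  have h2 := h.antitoneOn_deriv hg (Ioo_subset_Icc_self hc) (right_mem_Icc.2 h.lt.le) hc.2.le
  rw [hpc] at h1 h2
  have h3 : (p b - p a) * (p b + p a) = 0 := by linarith
  rcases mul_eq_zero.1 h3 with h4 | h4 <;> linarith

theorem le_slope_mul (h : IsBump g v p a b) (hg : IsUnitApprox g e) {c : ℝ}
    (hc : c ∈ Ioo a b) : v c ≤ p a * (c - a) := by
  have := sub_le_mul_of_hasDerivAt_le (C := p a) hc.1.le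
    (h.continuousOn.mono (Icc_subset_Icc_right hc.2.le))
    (fun z hz => h.hasDerivAt z ⟨hz.1, hz.2.trans hc.2⟩)
    (fun z hz => h.antitoneOn_deriv hg (left_mem_Icc.2 h.lt.le)
      ⟨hz.1.le, (hz.2.trans hc.2).le⟩ hz.1.le)
  rwa [h.left, sub_zero] at this

theorem slope_pos (h : IsBump g v p a b) (hg : IsUnitApprox g e) : 0 < p a := by
  obtain ⟨c, hc, -⟩ := h.exists_peak
  have h1 := (h.pos c hc).trans_le (h.le_slope_mul hg hc)
  exact (pos_iff_pos_of_mul_pos h1).2 (sub_pos.2 hc.1)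

theorem add_sub_mono (h : IsBump g v p a b) (hg : IsUnitApprox g e) {x y : ℝ}
    (hx : x ∈ Icc a b) (hy : y ∈ Icc a b) (hxy : x ≤ y) : p x + x ≤ p y + y := by
  have := mul_le_sub_of_le_hasDerivAt (C := -1) hxy
    (h.continuousOn_deriv.mono (Icc_subset_Icc hx.1 hy.2))
    (fun z hz => h.hasDerivAt_deriv z ⟨hx.1.trans_lt hz.1, hz.2.trans_le hy.2⟩)
    (fun z hz => neg_le_neg (hg.le_one _))
  linarith

/-- Where `v ≥ e`, the slope `p` falls at rate at least `1 - e`, while its total drop is `2 * p a`.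
The tent bound shows that the remaining set has proportion at most `e / v c`, and `v c ≥ p a ^ 2 /
2` by energy. -/
theorem length_le (h : IsBump g v p a b) (hg : IsUnitApprox g e) (hab : b - a ≤ 1) :
    b - a ≤ 2 * p a + e * (1 + 2 / p a ^ 2) := by
  obtain ⟨c, hc, hpc⟩ := h.exists_peak
  have hP := h.slope_pos hg
  have hM := h.pos c hc
  have hMP : p a ^ 2 ≤ 2 * v c := by
    nlinarith [h.sq_le hg hc hpc, hg.le_one (v c)]
  have hfrac : 1 / v c ≤ 2 / p a ^ 2 := by
    rw [div_le_div_iff₀ hM (by positivity)]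
    linarith
  have he := hg.pos
  have hle : e * (1 + 1 / v c) ≤ e * (1 + 2 / p a ^ 2) := by gcongr
  -- For a peak below `e` the error term alone exceeds `1`, hence the length.
  rcases le_or_gt (v c) e with hev | hev
  · have : 1 ≤ e * (1 / v c) := by
      rw [mul_one_div, le_div_iff₀ hM]
      linarith
    nlinarith
  · set θ := e / v c with hθ
    have hθ0 : 0 ≤ θ := by positivity
    have hθ1 : θ ≤ 1 := (div_le_one hM).2 hev.le
    have hca : 0 < c - a := sub_pos.2 hc.1
    have hbc : 0 < b - c := sub_pos.2 hc.2
    have k1 := mul_nonneg hθ0 hca.le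
    have k2 := mul_nonneg hθ0 hbc.le
    have k3 := mul_le_of_le_one_left hca.le hθ1
    have k4 := mul_le_of_le_one_left hbc.le hθ1
    have hy1 : a + θ * (c - a) ∈ Icc a b := ⟨by linarith, by linarith⟩
    have hy2 : b - θ * (b - c) ∈ Icc a b := ⟨by linarith, by linarith⟩
    have a1 := h.antitoneOn_deriv hg (left_mem_Icc.2 h.lt.le) hy1 hy1.1
    have a2 := h.antitoneOn_deriv hg hy2 (right_mem_Icc.2 h.lt.le) hy2.2
    have a3 := sub_le_mul_of_hasDerivAt_le (C := -(1 - e))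
      (show a + θ * (c - a) ≤ b - θ * (b - c) by linarith)
      (h.continuousOn_deriv.mono (Icc_subset_Icc hy1.1 hy2.2))
      (fun z hz => h.hasDerivAt_deriv z ⟨hy1.1.trans_lt hz.1, hz.2.trans_le hy2.2⟩)
      (fun z hz => by
        have := h.mul_le hg hc hθ0 (Ioo_subset_Icc_self hz)
        rw [hθ, div_mul_cancel₀ _ hM.ne'] at this
        exact neg_le_neg (hg.close _ this))
    have hb := h.right_eq_neg hg
    have hθe : e * (1 / v c) = θ := by rw [mul_one_div]
    have k5 : θ * (b - a) ≤ θ := mul_le_of_le_one_right hθ0 hab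
    have k6 : e * (b - a) ≤ e := mul_le_of_le_one_right he.le hab
    have k7 : 0 ≤ e * (θ * (b - a)) :=
      mul_nonneg he.le (mul_nonneg hθ0 (sub_pos.2 h.lt).le)
    nlinarith

/-- The derivative is close to the one of a parabola. -/
theorem deriv_bounds (h : IsBump g v p a b) (hg : IsUnitApprox g e) (hab : b - a ≤ 1) {x : ℝ}
    (hx : x ∈ Icc a b) : |p x - (p a - (x - a))| ≤ e * (1 + 2 / p a ^ 2) := by
  have h1 := h.add_sub_mono hg (left_mem_Icc.2 h.lt.le) hx hx.1
  have h2 := h.add_sub_mono hg hx (right_mem_Icc.2 h.lt.le) hx.2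
  have h3 := h.length_le hg hab
  have h4 := h.right_eq_neg hg
  rw [abs_le]
  constructor <;> linarith

/-- Long bumps are steep, since `g` is. -/
theorem le_slope (h : IsBump g v p a b) (hg : IsUnitApprox g e) (hab : b - a ≤ 1)
    (he : 128 * e < (1 - e) * (b - a) ^ 2) : (1 - e) * (b - a) ^ 2 / 128 ≤ p a := by
  obtain ⟨c, hc, hpc⟩ := h.exists_peak
  have hP := h.slope_pos hg
  have hM := h.pos c hc
  have hba := sub_pos.2 h.lt
  have he0 := hg.pos
  have hsq := h.sq_le hg hc hpc
  have hgM : 0 < g (v c) := by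
    have : 0 < v c * g (v c) := by nlinarith
    exact (pos_iff_pos_of_mul_pos this).1 hM
  -- On the middle half of the bump `v` is at least half its peak, so `p` drops there by at least `g
  -- (v c) * (b - a) / 4`. As the total drop is `2 * p a`, this yields `k1`; squaring and `sq_le`
  -- give the factor `128 = 2 * 64` in `k2`.
  have hhalf : g (v c) / 2 ≤ g (1 / 2 * v c) := by
    have := hg.concaveOn.2 (mem_Ici.2 le_rfl) (mem_Ici.2 hM.le)
      (show (0 : ℝ) ≤ 1 / 2 by norm_num) (show (0 : ℝ) ≤ 1 / 2 by norm_num) (by norm_num)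
    simp only [smul_eq_mul, hg.map_zero, mul_zero, zero_add] at this
    linarith
  have hy1 : a + 1 / 2 * (c - a) ∈ Icc a b := ⟨by linarith [hc.1], by linarith [hc.1, hc.2]⟩
  have hy2 : b - 1 / 2 * (b - c) ∈ Icc a b := ⟨by linarith [hc.1, hc.2], by linarith [hc.2]⟩
  have a1 := h.antitoneOn_deriv hg (left_mem_Icc.2 h.lt.le) hy1 hy1.1
  have a2 := h.antitoneOn_deriv hg hy2 (right_mem_Icc.2 h.lt.le) hy2.2
  have a3 := sub_le_mul_of_hasDerivAt_le (C := -(g (v c) / 2))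
    (show a + 1 / 2 * (c - a) ≤ b - 1 / 2 * (b - c) by linarith)
    (h.continuousOn_deriv.mono (Icc_subset_Icc hy1.1 hy2.2))
    (fun z hz => h.hasDerivAt_deriv z ⟨hy1.1.trans_lt hz.1, hz.2.trans_le hy2.2⟩)
    (fun z hz => neg_le_neg (hhalf.trans (hg.monotone
      (h.mul_le hg hc (by norm_num) (Ioo_subset_Icc_self hz)))))
  have hb := h.right_eq_neg hg
  have k1 : g (v c) * (b - a) ≤ 8 * p a := by nlinarith
  have k2 : g (v c) * (b - a) ^ 2 ≤ 128 * v c := by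
    have : (g (v c) * (b - a)) ^ 2 ≤ (8 * p a) ^ 2 := by gcongr
    have : g (v c) * (g (v c) * (b - a) ^ 2) ≤ g (v c) * (128 * v c) := by nlinarith
    exact le_of_mul_le_mul_left this hgM
  have hMP : v c ≤ p a := by
    refine (h.le_slope_mul hg hc).trans (mul_le_of_le_one_right hP.le ?_)
    linarith [hc.2]
  rcases le_or_gt e (v c) with hev | hev
  · have := mul_le_mul_of_nonneg_right (hg.close _ hev) (sq_nonneg (b - a))
    linarith
  · exfalso
    -- Below `e`, concavity keeps `g` above the chord from `0` to `e`, of slope at least `(1 - e) /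
    -- e`; so small a peak contradicts `k2` and the assumed length.
    have hconc := hg.concaveOn.2 (mem_Ici.2 le_rfl) (mem_Ici.2 he0.le)
      (sub_nonneg.2 ((div_le_one he0).2 hev.le)) (by positivity : 0 ≤ v c / e) (by ring)
    simp only [smul_eq_mul, hg.map_zero, mul_zero, zero_add] at hconc
    rw [div_mul_cancel₀ _ he0.ne', div_mul_eq_mul_div, div_le_iff₀ he0] at hconc
    have k3 := mul_le_mul_of_nonneg_left (hg.close e le_rfl) hM.le
    have k4 : v c * ((1 - e) * (b - a) ^ 2) ≤ v c * (128 * e) := by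
      have := mul_le_mul_of_nonneg_right (k3.trans hconc) (sq_nonneg (b - a))
      nlinarith
    exact absurd (le_of_mul_le_mul_left k4 hM) (not_le.2 he)

end IsBump

/-! ### Fixed points of the regularized problem -/

/-- Shift both points by `δ > 0` into the open half-line and let `δ → 0`. -/
theorem ConcaveOn.Ici_of_Ioi {g : ℝ → ℝ} {a : ℝ} (hc : Continuous g)
    (h : ConcaveOn ℝ (Ioi a) g) : ConcaveOn ℝ (Ici a) g := by
  refine ⟨convex_Ici a, fun x hx y hy r t hr ht hrt => ?_⟩
  have h1 : Tendsto (fun δ : ℝ => r • g (x + δ) + t • g (y + δ)) (𝓝[>] 0)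
      (𝓝 (r • g x + t • g y)) := by
    have : Continuous fun δ : ℝ => r • g (x + δ) + t • g (y + δ) := by fun_prop
    simpa using (this.tendsto 0).mono_left nhdsWithin_le_nhds
  have h2 : Tendsto (fun δ : ℝ => g (r • (x + δ) + t • (y + δ))) (𝓝[>] 0)
      (𝓝 (g (r • x + t • y))) := by
    have : Continuous fun δ : ℝ => g (r • (x + δ) + t • (y + δ)) := by fun_prop
    simpa using (this.tendsto 0).mono_left nhdsWithin_le_nhds
  refine le_of_tendsto_of_tendsto h1 h2 ?_
  filter_upwards [self_mem_nhdsWithin] with δ hδ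
  have hx' : a ≤ x := hx
  have hy' : a ≤ y := hy
  have hδ' : 0 < δ := hδ
  exact h.2 (mem_Ioi.2 (by linarith)) (mem_Ioi.2 (by linarith)) hr ht hrt

/-- The family is not assumed odd. The reflection `s = -1` turns convexity on the negative half-line
into concavity on the positive one, so one analysis of bumps serves both signs. -/
theorem IsApproxFamily.isUnitApprox {f : ℝ → ℝ → ℝ} (hf : IsApproxFamily f) {e : ℝ}
    (he : e ∈ Ioc (0 : ℝ) 1) {s : ℝ} (hs : s = 1 ∨ s = -1) :
    IsUnitApprox (fun y => s * f e (s * y)) e := by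
  have hc := hf.continuous e he
  have hlim : ∀ g : ℝ → ℝ, Continuous g → (∀ y, e < y → 1 - e ≤ g y) →
      ∀ y, e ≤ y → 1 - e ≤ g y := by
    intro g hg h y hy
    have hcl : IsClosed {z | 1 - e ≤ g z} := isClosed_le continuous_const hg
    have : closure (Ioi e) ⊆ {z | 1 - e ≤ g z} := closure_minimal h hcl
    rw [closure_Ioi] at this
    exact this hy
  have hcs : Continuous fun y => s * f e (s * y) := by fun_prop
  refine ⟨he.1, hcs, ?_, by simp [hf.map_zero e he], ?_, ?_, hlim _ hcs ?_⟩
  · intro x y hxy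
    rcases hs with rfl | rfl
    · simpa using hf.monotone e he hxy
    · simpa using hf.monotone e he (neg_le_neg hxy)
  · intro y
    rcases hs with rfl | rfl
    · simpa using (hf.bounded e he y).2.le
    · have := (hf.bounded e he (-y)).1.le
      simp only [neg_mul, one_mul]
      linarith
  · refine ConcaveOn.Ici_of_Ioi hcs ?_
    rcases hs with rfl | rfl
    · simpa using (hf.strictConcave e he).concaveOn
    · refine ⟨convex_Ioi 0, fun x hx y hy r t hr ht hrt => ?_⟩
      have := (hf.strictConvex e he).convexOn.2 (mem_Iio.2 (neg_lt_zero.2 hx))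
        (mem_Iio.2 (neg_lt_zero.2 hy)) hr ht hrt
      simp only [smul_eq_mul, neg_mul, one_mul] at this ⊢
      rw [show -(r * x + t * y) = r * -x + t * -y by ring]
      linarith
  · intro y hy
    have hy0 : 0 < y := he.1.trans hy
    rcases hs with rfl | rfl
    · have := hf.close e he y (by rwa [abs_of_pos hy0]) 1
        ⟨fun h => absurd h hy0.not_gt, fun h => absurd h hy0.ne', fun _ => rfl⟩
      simp only [one_mul]
      linarith [(abs_lt.1 this).1]
    · have := hf.close e he (-y) (by rwa [abs_neg, abs_of_pos hy0]) (-1)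
        ⟨fun _ => rfl, fun h => absurd h (by linarith), fun h => absurd h (by linarith)⟩
      simp only [neg_mul, one_mul]
      linarith [(abs_lt.1 this).2]

theorem hasDerivAt_primitive {h : ℝ → ℝ} (hh : ContinuousOn h (Icc 0 1)) {x : ℝ}
    (hx : x ∈ Ioo (0 : ℝ) 1) : HasDerivAt (fun y => ∫ t in (0 : ℝ)..y, h t) (h x) x := by
  have hsub : uIcc 0 x ⊆ Icc (0 : ℝ) 1 := by
    rw [uIcc_of_le hx.1.le]
    exact Icc_subset_Icc_right hx.2.le
  refine intervalIntegral.integral_hasDerivAt_right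
    ((hh.mono hsub).intervalIntegrable) ?_ (hh.continuousAt (Icc_mem_nhds hx.1 hx.2))
  exact (hh.mono Ioo_subset_Icc_self).stronglyMeasurableAtFilter isOpen_Ioo x hx

/-- Fixed points of the regularized problem are classical solutions. -/
theorem IsFixedPointODE.exists_classical {g w : ℝ → ℝ} (hg : Continuous g)
    (h : IsFixedPointODE g w) :
    ∃ p, IsWeakDeriv w p ∧ ContinuousOn p (Icc 0 1) ∧
      (∀ x ∈ Ioo (0 : ℝ) 1, HasDerivAt w (p x) x) ∧
      ∀ x ∈ Ioo (0 : ℝ) 1, HasDerivAt p (-g (w x)) x := by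
  obtain ⟨hw, hode⟩ := h
  have hwd : IsWeakDeriv w (weakDeriv w) := isWeakDeriv_weakDeriv hw.1.2
  have hgc : ContinuousOn (fun x => -g (w x)) (Icc 0 1) := (hg.comp_continuousOn hw.2.1).neg
  have hwd2 : IsWeakDeriv (weakDeriv w) (fun x => -g (w x)) := by
    refine ⟨memLp_of_continuousOn hgc, fun φ hφ => ?_⟩
    -- Testing with smooth functions identifies the continuous function `-g (w x)` as the weak
    -- derivative of `weakDeriv w`.
    have := hode φ hφ.memH10
    simp_rw [neg_mul]
    rw [integral_neg, neg_neg, ← this]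
    refine integral_congr_ae ?_
    filter_upwards [hφ.isWeakDeriv.weakDeriv_ae_eq] with x hx
    rw [hx]
  obtain ⟨c, hc⟩ := hwd2.exists_ae_eq_primitive hwd.1
  have hp := hwd.congr_right hc
  have hpc : ContinuousOn (fun x => c + ∫ t in (0 : ℝ)..x, -g (w t)) (Icc 0 1) :=
    continuousOn_const.add (continuousOn_primitive hwd2.1.integrable_volΩ)
  refine ⟨_, hp, hpc, fun x hx => ?_, fun x hx => (hasDerivAt_primitive hgc hx).const_add c⟩
  refine (hasDerivAt_primitive hpc hx).congr_of_eventuallyEq ?_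
  filter_upwards [Icc_mem_nhds hx.1 hx.2] with y hy
  exact hw.eq_primitive hp y hy

theorem sign_mul_neg_one_pow {σ : ℝ} (hσ : σ = 1 ∨ σ = -1) (q : ℕ) :
    σ * (-1) ^ q = 1 ∨ σ * (-1) ^ q = -1 := by
  rcases hσ with rfl | rfl <;> rcases neg_one_pow_eq_or ℝ q with h | h <;> simp [h]

theorem nodes_mem_Icc {x : ℕ → ℝ} {k : ℕ} (h0 : x 0 = 0) (hk : x k = 1)
    (hlt : ∀ q < k, x q < x (q + 1)) {q : ℕ} (hq : q ≤ k) : x q ∈ Icc (0 : ℝ) 1 := by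
  have h1 : ∀ q ≤ k, 0 ≤ x q := by
    intro q
    induction q with
    | zero => intro _; exact h0.ge
    | succ n ih => intro hn; exact (ih (by omega)).trans (hlt n (by omega)).le
  have h2 : ∀ j q, q + j = k → x q ≤ 1 := by
    intro j
    induction j with
    | zero => intro q hq; exact (hk ▸ (by rw [← hq, add_zero]) : x q = 1).le
    | succ n ih => intro q hq; exact (hlt q (by omega)).le.trans (ih (q + 1) (by omega))
  exact ⟨h1 q hq, h2 (k - q) q (by omega)⟩

theorem exists_long_cell {x : ℕ → ℝ} {k : ℕ} (hk1 : 1 ≤ k) (h0 : x 0 = 0) (hk : x k = 1) :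
    ∃ q < k, 1 / (k : ℝ) ≤ x (q + 1) - x q := by
  have hk0 : (k : ℝ) ≠ 0 := by positivity
  have hs : ∑ _q ∈ Finset.range k, 1 / (k : ℝ) ≤ ∑ q ∈ Finset.range k, (x (q + 1) - x q) := by
    rw [Finset.sum_range_sub, h0, hk, Finset.sum_const, Finset.card_range, nsmul_eq_mul,
      mul_one_div_cancel hk0, sub_zero]
  obtain ⟨q, hq, h⟩ := Finset.exists_le_of_sum_le (Finset.nonempty_range_iff.2 (by omega)) hs
  exact ⟨q, Finset.mem_range.1 hq, h⟩

/-- Quantitative description of a fixed point of the regularized problem with nodes `x`: its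
derivative `p` is close to a piecewise affine function. -/
structure NodalEstimate (e σ : ℝ) (k : ℕ) (w p : ℝ → ℝ) (P : ℝ) (x : ℕ → ℝ) : Prop where
  isWeakDeriv : IsWeakDeriv w p
  memLp : MemLp w 2 volΩ
  slope_pos : 0 < P
  zero : x 0 = 0
  last : x k = 1
  abs_le : ∀ y ∈ Icc (0 : ℝ) 1, |p y| ≤ P + 1
  close : ∀ q < k, ∀ y ∈ Icc (x q) (x (q + 1)),
    |σ * (-1) ^ q * p y - (P - (y - x q))| ≤ e * (1 + 2 / P ^ 2)
  length_close : ∀ q < k, |x (q + 1) - x q - 2 * P| ≤ e * (1 + 2 / P ^ 2)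
  le_slope : 128 * e < (1 - e) * (1 / (k : ℝ)) ^ 2 → (1 - e) * (1 / (k : ℝ)) ^ 2 / 128 ≤ P

theorem exists_nodalEstimate {f : ℝ → ℝ → ℝ} (hf : IsApproxFamily f) {e : ℝ}
    (he : e ∈ Ioc (0 : ℝ) 1) {k : ℕ} (hk : 1 ≤ k) {σ : ℝ} (hσ : σ = 1 ∨ σ = -1) {w : ℝ → ℝ}
    (hw : IsFixedPointODE (f e) w) (hn : HasNodalPattern σ k w) :
    ∃ p P x, NodalEstimate e σ k w p P x := by
  obtain ⟨p, hp, hpc, hd, hdd⟩ := hw.exists_classical (hf.continuous e he)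
  obtain ⟨x, hx0, hxk, hlt, hz, hpos⟩ := hn
  have hmem : ∀ q ≤ k, x q ∈ Icc (0 : ℝ) 1 := fun q hq => nodes_mem_Icc hx0 hxk hlt hq
  have hbump : ∀ q < k, IsBump (fun y => σ * (-1) ^ q * f e (σ * (-1) ^ q * y))
      (fun y => σ * (-1) ^ q * w y) (fun y => σ * (-1) ^ q * p y) (x q) (x (q + 1)) := by
    intro q hq
    have hm1 := (hmem q hq.le).1
    have hm2 := (hmem (q + 1) hq).2
    have hsub : Icc (x q) (x (q + 1)) ⊆ Icc 0 1 := Icc_subset_Icc hm1 hm2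
    have hsub' : Ioo (x q) (x (q + 1)) ⊆ Ioo 0 1 := Ioo_subset_Ioo hm1 hm2
    have hs : σ * (-1) ^ q * (σ * (-1) ^ q) = 1 := by
      rcases sign_mul_neg_one_pow hσ q with h | h <;> rw [h] <;> norm_num
    refine ⟨hlt q hq, continuousOn_const.mul (hw.1.2.1.mono hsub),
      continuousOn_const.mul (hpc.mono hsub), fun y hy => (hd y (hsub' hy)).const_mul _,
      fun y hy => ?_, by simp [hz q hq.le], by simp [hz (q + 1) hq], hpos q hq⟩
    refine ((hdd y (hsub' hy)).const_mul (σ * (-1) ^ q)).congr_deriv ?_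
    rw [← mul_assoc, hs, one_mul, mul_neg]
  have hua : ∀ q, IsUnitApprox (fun y => σ * (-1) ^ q * f e (σ * (-1) ^ q * y)) e := fun q =>
    hf.isUnitApprox he (sign_mul_neg_one_pow hσ q)
  -- The slope reverses across each bump, as does the reflecting sign; hence a single `P = σ * p 0`
  -- serves all cells.
  have hslope : ∀ q ≤ k, σ * (-1) ^ q * p (x q) = σ * p 0 := by
    intro q
    induction q with
    | zero => intro _; simp [hx0]
    | succ n ih =>
      intro hn
      have := (hbump n hn).right_eq_neg (hua n)
      rw [← ih (by omega), pow_succ]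
      linarith
  have hlen : ∀ q < k, x (q + 1) - x q ≤ 1 := fun q hq => by
    linarith [(hmem q hq.le).1, (hmem (q + 1) hq).2]
  have hclose : ∀ q < k, ∀ y ∈ Icc (x q) (x (q + 1)),
      |σ * (-1) ^ q * p y - (σ * p 0 - (y - x q))| ≤ e * (1 + 2 / (σ * p 0) ^ 2) := by
    intro q hq y hy
    have := (hbump q hq).deriv_bounds (hua q) (hlen q hq) hy
    simpa only [hslope q hq.le] using this
  have hP : 0 < σ * p 0 := by
    have := (hbump 0 hk).slope_pos (hua 0)
    simpa only [hslope 0 (by omega)] using this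
  refine ⟨p, σ * p 0, x, hp, hw.1.1.1, hP, hx0, hxk, ?_, hclose, ?_, ?_⟩
  · intro y hy
    have hsub : Icc 0 y ⊆ Icc (0 : ℝ) 1 := Icc_subset_Icc_right hy.2
    have hb := hf.bounded e he
    have h1 := sub_le_mul_of_hasDerivAt_le (C := 1) hy.1 (hpc.mono hsub)
      (fun z hz => hdd z ⟨hz.1, hz.2.trans_le hy.2⟩) (fun z _ => by linarith [(hb (w z)).1])
    have h2 := mul_le_sub_of_le_hasDerivAt (C := -1) hy.1 (hpc.mono hsub)
      (fun z hz => hdd z ⟨hz.1, hz.2.trans_le hy.2⟩) (fun z _ => by linarith [(hb (w z)).2])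
    have h3 : |p 0| = σ * p 0 := by
      rcases hσ with rfl | rfl
      · rw [one_mul] at hP ⊢
        exact abs_of_pos hP
      · rw [neg_one_mul] at hP ⊢
        exact abs_of_neg (neg_pos.1 hP)
    have h4 := abs_le.1 h3.le
    rw [abs_le]
    constructor <;> linarith [hy.2]
  · intro q hq
    have h1 := hclose q hq _ (right_mem_Icc.2 (hlt q hq).le)
    have h2 := hslope (q + 1) hq
    rw [pow_succ] at h2
    have h3 : σ * (-1) ^ q * p (x (q + 1)) = -(σ * p 0) := by linarith
    rw [h3] at h1
    convert h1 using 2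
    ring
  · intro hek
    obtain ⟨q, hq, hlong⟩ := exists_long_cell hk hx0 hxk
    have he1 : 0 ≤ 1 - e := by linarith [he.2]
    have hsq : (1 - e) * (1 / (k : ℝ)) ^ 2 ≤ (1 - e) * (x (q + 1) - x q) ^ 2 := by gcongr
    have := (hbump q hq).le_slope (hua q) (hlen q hq) (hek.trans_le hsq)
    simp only [hslope q hq.le] at this
    linarith

/-! ### Limits of slopes, nodes and derivatives -/

namespace NodalEstimate

variable {e : ℕ → ℝ} {σ : ℝ} {k : ℕ} {w p : ℕ → ℝ → ℝ} {P : ℕ → ℝ} {x : ℕ → ℕ → ℝ}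

theorem tendsto_error (he : ∀ m, e m ∈ Ioc (0 : ℝ) 1) (he0 : Tendsto e atTop (𝓝 0)) (hk : 1 ≤ k)
    (h : ∀ᶠ m in atTop, NodalEstimate (e m) σ k (w m) (p m) (P m) (x m)) :
    Tendsto (fun m => e m * (1 + 2 / P m ^ 2)) atTop (𝓝 0) := by
  have hk0 : (0 : ℝ) < (1 / (k : ℝ)) ^ 2 := by positivity
  -- Lower bound for the slopes: once `e m < 1 / 2`, the factor `1 - e m` costs at most `2`, and
  -- `256 = 2 * 128`.
  set c : ℝ := (1 / (k : ℝ)) ^ 2 / 256 with hc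
  have hc0 : 0 < c := by positivity
  have hlim : Tendsto (fun m => e m * (1 + 2 / c ^ 2)) atTop (𝓝 0) := by
    simpa using he0.mul_const (1 + 2 / c ^ 2)
  have hsmall : ∀ᶠ m in atTop, e m < min (1 / 2) c / 2 :=
    he0.eventually (gt_mem_nhds (by positivity))
  refine tendsto_of_tendsto_of_tendsto_of_le_of_le' tendsto_const_nhds hlim ?_ ?_
  · filter_upwards with m
    have := (he m).1
    positivity
  · filter_upwards [h, hsmall] with m hm hs
    have h0 := (he m).1
    have h1 : e m < 1 / 2 := hs.trans_le (by linarith [min_le_left (1 / 2) c])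
    have h2 : e m < c / 2 := hs.trans_le (by linarith [min_le_right (1 / 2) c])
    have h3 : 1 / 2 * (1 / (k : ℝ)) ^ 2 ≤ (1 - e m) * (1 / (k : ℝ)) ^ 2 :=
      mul_le_mul_of_nonneg_right (by linarith) hk0.le
    have h4 : c ≤ P m := by
      have := hm.le_slope (by linarith)
      linarith
    gcongr

/-- The `k` cell lengths sum to `1` and each is `2 * P m` up to the error. -/
theorem tendsto_slope (hk : 1 ≤ k)
    (h : ∀ᶠ m in atTop, NodalEstimate (e m) σ k (w m) (p m) (P m) (x m))
    (herr : Tendsto (fun m => e m * (1 + 2 / P m ^ 2)) atTop (𝓝 0)) :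
    Tendsto P atTop (𝓝 (1 / (2 * k))) := by
  have hk0 : (0 : ℝ) < k := by positivity
  rw [tendsto_iff_dist_tendsto_zero]
  refine squeeze_zero' (Eventually.of_forall fun _ => dist_nonneg) ?_ herr
  filter_upwards [h] with m hm
  have hsum : |∑ q ∈ Finset.range k, (x m (q + 1) - x m q - 2 * P m)|
      ≤ k * (e m * (1 + 2 / P m ^ 2)) := by
    refine (Finset.abs_sum_le_sum_abs _ _).trans ?_
    refine (Finset.sum_le_card_nsmul _ _ _ fun q hq =>
      hm.length_close q (Finset.mem_range.1 hq)).trans ?_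
    rw [Finset.card_range, nsmul_eq_mul]
  rw [Finset.sum_sub_distrib, Finset.sum_range_sub, hm.zero, hm.last, Finset.sum_const,
    Finset.card_range, nsmul_eq_mul, sub_zero] at hsum
  have hrw : P m - 1 / (2 * k) = -((1 - k * (2 * P m)) / (2 * k)) := by
    field_simp
    ring
  rw [Real.dist_eq, hrw, abs_neg, abs_div, abs_of_pos (by positivity : (0 : ℝ) < 2 * k),
    div_le_iff₀ (by positivity)]
  have := (abs_nonneg _).trans hsum
  linarith

theorem tendsto_node
    (h : ∀ᶠ m in atTop, NodalEstimate (e m) σ k (w m) (p m) (P m) (x m))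
    (herr : Tendsto (fun m => e m * (1 + 2 / P m ^ 2)) atTop (𝓝 0))
    (hP : Tendsto P atTop (𝓝 (1 / (2 * k)))) {q : ℕ} (hq : q ≤ k) :
    Tendsto (fun m => x m q) atTop (𝓝 (q / k)) := by
  induction q with
  | zero =>
    refine tendsto_const_nhds.congr' ?_
    filter_upwards [h] with m hm
    simp [hm.zero]
  | succ n ih =>
    have h1 : Tendsto (fun m => x m (n + 1) - x m n - 2 * P m) atTop (𝓝 0) := by
      refine squeeze_zero_norm' ?_ herr
      filter_upwards [h] with m hm
      exact hm.length_close n hq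
    have h2 := (h1.add (ih (by omega))).add (hP.const_mul 2)
    have hk0 : (k : ℝ) ≠ 0 := by
      have : 0 < k := by omega
      positivity
    convert h2 using 2
    · ring
    · push_cast
      field_simp
      ring

theorem tendsto_deriv
    (h : ∀ᶠ m in atTop, NodalEstimate (e m) σ k (w m) (p m) (P m) (x m))
    (herr : Tendsto (fun m => e m * (1 + 2 / P m ^ 2)) atTop (𝓝 0))
    (hP : Tendsto P atTop (𝓝 (1 / (2 * k)))) (hσ : σ = 1 ∨ σ = -1) {q : ℕ} (hq : q < k) {y : ℝ}
    (hy : y ∈ Ioo (q / k : ℝ) ((q + 1) / k)) :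
    Tendsto (fun m => p m y) atTop (𝓝 (σ * (-1) ^ q * (1 / (2 * k) - (y - q / k)))) := by
  have hx1 := tendsto_node h herr hP hq.le
  have hx2 := tendsto_node h herr hP (q := q + 1) hq
  push_cast at hx2
  have hs : σ * (-1) ^ q * (σ * (-1) ^ q) = 1 := by
    rcases sign_mul_neg_one_pow hσ q with h | h <;> rw [h] <;> norm_num
  have h1 : Tendsto (fun m => σ * (-1) ^ q * p m y - (P m - (y - x m q))) atTop (𝓝 0) := by
    refine squeeze_zero_norm' ?_ herr
    -- An interior point of the limiting cell eventually lies in the moving cell with the same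
    -- index.
    filter_upwards [h, hx1.eventually (gt_mem_nhds hy.1), hx2.eventually (lt_mem_nhds hy.2)]
      with m hm hm1 hm2
    exact hm.close q hq y ⟨hm1.le, hm2.le⟩
  have h2 := (h1.add (hP.sub ((tendsto_const_nhds (x := y)).sub hx1))).const_mul (σ * (-1) ^ q)
  rw [zero_add] at h2
  refine h2.congr fun m => ?_
  rw [sub_add_cancel, ← mul_assoc, hs, one_mul]

end NodalEstimate

/-! ### Fixed points of the inclusion -/

/-- Where the second derivative is constant, a function is a parabola. -/
theorem parabola_of_ae_eq {g p v : ℝ → ℝ} {c s a b : ℝ} (hg : Integrable g volΩ)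
    (hp : ∀ x ∈ Icc (0 : ℝ) 1, p x = c - ∫ t in (0 : ℝ)..x, g t)
    (hv : ∀ x ∈ Icc (0 : ℝ) 1, v x = ∫ t in (0 : ℝ)..x, p t) (ha : 0 ≤ a) (hb : b ≤ 1)
    (hs : ∀ᵐ x ∂volΩ, x ∈ Ioo a b → g x = s) {x : ℝ} (hx : x ∈ Icc a b) :
    p x = p a - s * (x - a) ∧ v x = v a + p a * (x - a) - s * (x - a) ^ 2 / 2 := by
  have hI : ∀ y ∈ Icc (0 : ℝ) 1, ∀ z ∈ Icc (0 : ℝ) 1, IntervalIntegrable g volume y z := by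
    intro y hy z hz
    exact hg.intervalIntegrable_unit.mono_set (uIcc_subset_uIcc
      (by rwa [uIcc_of_le zero_le_one]) (by rwa [uIcc_of_le zero_le_one]))
  have h0 : (0 : ℝ) ∈ Icc (0 : ℝ) 1 := left_mem_Icc.2 zero_le_one
  have hsub : Icc a b ⊆ Icc 0 1 := Icc_subset_Icc ha hb
  have haI : a ∈ Icc a b := left_mem_Icc.2 (hx.1.trans hx.2)
  have hpx : ∀ y ∈ Icc a b, p y = p a - s * (y - a) := by
    intro y hy
    have h1 := intervalIntegral.integral_add_adjacent_intervals (hI 0 h0 a (hsub haI))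
      (hI a (hsub haI) y (hsub hy))
    have h2 : ∫ t in a..y, g t = ∫ _ in a..y, s := by
      rw [intervalIntegral.integral_of_le hy.1, intervalIntegral.integral_of_le hy.1,
        integral_Ioc_eq_integral_Ioo, integral_Ioc_eq_integral_Ioo]
      refine integral_congr_ae ?_
      have hle : volume.restrict (Ioo a y) ≤ volΩ :=
        Measure.restrict_mono (Ioo_subset_Ioo ha (hy.2.trans hb)) le_rfl
      filter_upwards [ae_mono hle hs, ae_restrict_mem measurableSet_Ioo] with t ht ht'
      exact ht ⟨ht'.1, ht'.2.trans_le hy.2⟩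
    rw [h2, intervalIntegral.integral_const, smul_eq_mul] at h1
    rw [hp y (hsub hy), hp a (hsub haI), ← h1]
    ring
  refine ⟨hpx x hx, ?_⟩
  have hpc : ContinuousOn p (Icc 0 1) :=
    (continuousOn_const.sub (continuousOn_primitive hg)).congr hp
  have hIp : ∀ y ∈ Icc (0 : ℝ) 1, ∀ z ∈ Icc (0 : ℝ) 1, IntervalIntegrable p volume y z := by
    intro y hy z hz
    exact (hpc.mono (uIcc_subset_Icc hy hz)).intervalIntegrable
  have h1 := intervalIntegral.integral_add_adjacent_intervals (hIp 0 h0 a (hsub haI))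
    (hIp a (hsub haI) x (hsub hx))
  have h2 : ∫ t in a..x, p t = ∫ t in a..x, (p a - s * (t - a)) := by
    refine intervalIntegral.integral_congr fun t ht => ?_
    rw [uIcc_of_le hx.1] at ht
    exact hpx t ⟨ht.1, ht.2.trans hx.2⟩
  have h3 : ∫ t in a..x, (p a - s * (t - a)) = p a * (x - a) - s * (x - a) ^ 2 / 2 := by
    rw [intervalIntegral.integral_sub (by simp) (by
        apply Continuous.intervalIntegrable; fun_prop),
      intervalIntegral.integral_const, intervalIntegral.integral_const_mul,
      intervalIntegral.integral_sub (by simp) (by simp), integral_id,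
      intervalIntegral.integral_const]
    simp only [smul_eq_mul]
    ring
  rw [hv x (hsub hx), hv a (hsub haI), ← h1, h2, h3]
  ring

/-- The right hand side of the fixed point of type `(k, σ)` of the inclusion. -/
noncomputable def nodalSign (σ : ℝ) (k : ℕ) (x : ℝ) : ℝ := σ * (-1) ^ ⌊k * x⌋₊

/-- The derivative of the fixed point of type `(k, σ)` of the inclusion. -/
noncomputable def nodalSlope (σ : ℝ) (k : ℕ) (x : ℝ) : ℝ :=
  σ * (1 / (2 * k)) - ∫ t in (0 : ℝ)..x, nodalSign σ k t

/-- The fixed point of type `(k, σ)` of the inclusion. -/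
noncomputable def nodalProfile (σ : ℝ) (k : ℕ) (x : ℝ) : ℝ :=
  ∫ t in (0 : ℝ)..x, nodalSlope σ k t

/-! ### Existence, explicit form and uniqueness for the inclusion -/

section Profile

variable {σ : ℝ} {k : ℕ}

theorem memLp_nodalSign (hσ : σ = 1 ∨ σ = -1) : MemLp (nodalSign σ k) 2 volΩ := by
  have hm : Measurable (nodalSign σ k) := by
    have : Measurable fun n : ℕ => σ * (-1 : ℝ) ^ n := measurable_from_nat
    exact this.comp (Nat.measurable_floor.comp (measurable_const_mul (k : ℝ)))
  refine MemLp.of_bound hm.aestronglyMeasurable 1 (Eventually.of_forall fun x => ?_)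
  rcases sign_mul_neg_one_pow hσ ⌊k * x⌋₊ with h | h <;> simp [nodalSign, h]

theorem nodalSign_eq (hk : 1 ≤ k) {q : ℕ} {x : ℝ} (hx : x ∈ Ico (q / k : ℝ) ((q + 1) / k)) :
    nodalSign σ k x = σ * (-1) ^ q := by
  have hk0 : (0 : ℝ) < k := by positivity
  have h1 := (div_le_iff₀ hk0).1 hx.1
  have h2 := (lt_div_iff₀ hk0).1 hx.2
  rw [nodalSign, (Nat.floor_eq_iff (by linarith [Nat.cast_nonneg (α := ℝ) q])).2
    ⟨by linarith, by linarith⟩]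

theorem continuousOn_nodalSlope (hσ : σ = 1 ∨ σ = -1) :
    ContinuousOn (nodalSlope σ k) (Icc 0 1) :=
  continuousOn_const.sub (continuousOn_primitive (memLp_nodalSign hσ).integrable_volΩ)

theorem nodal_cell (hk : 1 ≤ k) (hσ : σ = 1 ∨ σ = -1) {q : ℕ} (hq : q < k) {x : ℝ}
    (hx : x ∈ Icc (q / k : ℝ) ((q + 1) / k)) :
    nodalSlope σ k x = nodalSlope σ k (q / k) - σ * (-1) ^ q * (x - q / k) ∧
    nodalProfile σ k x = nodalProfile σ k (q / k) + nodalSlope σ k (q / k) * (x - q / k)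
      - σ * (-1) ^ q * (x - q / k) ^ 2 / 2 := by
  have hk0 : (0 : ℝ) < k := by positivity
  refine parabola_of_ae_eq (memLp_nodalSign (k := k) hσ).integrable_volΩ (fun _ _ => rfl)
    (fun _ _ => rfl) (by positivity) ?_ (Eventually.of_forall fun y hy => ?_) hx
  · rw [div_le_one hk0]
    exact_mod_cast hq
  · exact nodalSign_eq hk (Ioo_subset_Ico_self hy)

/-- The initial slope `1 / (2 * k)` is chosen so that crossing a cell of length `1 / k` reverses the
slope and returns the profile to zero. -/
theorem nodal_node (hk : 1 ≤ k) (hσ : σ = 1 ∨ σ = -1) {q : ℕ} (hq : q ≤ k) :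
    nodalSlope σ k (q / k) = σ * (-1) ^ q * (1 / (2 * k)) ∧ nodalProfile σ k (q / k) = 0 := by
  induction q with
  | zero => simp [nodalSlope, nodalProfile]
  | succ n ih =>
    have hk0 : (0 : ℝ) < k := by positivity
    obtain ⟨h1, h2⟩ := ih (by omega)
    have hd : ((n : ℝ) + 1) / k - n / k = 1 / k := by ring
    obtain ⟨h3, h4⟩ := nodal_cell hk hσ hq (x := (n + 1) / k)
      (right_mem_Icc.2 (by gcongr; linarith))
    rw [h1, hd] at h3 h4
    rw [h2] at h4
    push_cast
    constructor
    · rw [h3, pow_succ]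
      field_simp
      ring
    · rw [h4]
      field_simp
      ring

theorem nodalSlope_eq (hk : 1 ≤ k) (hσ : σ = 1 ∨ σ = -1) {q : ℕ} (hq : q < k) {x : ℝ}
    (hx : x ∈ Icc (q / k : ℝ) ((q + 1) / k)) :
    nodalSlope σ k x = σ * (-1) ^ q * (1 / (2 * k) - (x - q / k)) := by
  rw [(nodal_cell hk hσ hq hx).1, (nodal_node hk hσ hq.le).1]
  ring

theorem nodalProfile_eq (hk : 1 ≤ k) (hσ : σ = 1 ∨ σ = -1) {q : ℕ} (hq : q < k) {x : ℝ}
    (hx : x ∈ Icc (q / k : ℝ) ((q + 1) / k)) :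
    nodalProfile σ k x = σ * (-1) ^ q * ((x - q / k) * ((q + 1) / k - x) / 2) := by
  have hk0 : (0 : ℝ) < k := by positivity
  rw [(nodal_cell hk hσ hq hx).2, (nodal_node hk hσ hq.le).1, (nodal_node hk hσ hq.le).2]
  field_simp
  ring

theorem exists_cell (hk : 1 ≤ k) {x : ℝ} (hx : x ∈ Ico (0 : ℝ) 1) :
    ∃ q < k, x ∈ Ico (q / k : ℝ) ((q + 1) / k) := by
  have hk0 : (0 : ℝ) < k := by positivity
  have h0 : 0 ≤ k * x := mul_nonneg hk0.le hx.1
  refine ⟨⌊k * x⌋₊, ?_, ?_, ?_⟩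
  · rw [Nat.floor_lt h0]
    nlinarith [hx.2]
  · rw [div_le_iff₀ hk0]
    linarith [Nat.floor_le h0]
  · rw [lt_div_iff₀ hk0]
    linarith [Nat.lt_floor_add_one (k * x)]

theorem nodalProfile_pos (hk : 1 ≤ k) (hσ : σ = 1 ∨ σ = -1) {q : ℕ} (hq : q < k) {x : ℝ}
    (hx : x ∈ Ioo (q / k : ℝ) ((q + 1) / k)) : 0 < σ * (-1) ^ q * nodalProfile σ k x := by
  have hs : σ * (-1) ^ q * (σ * (-1) ^ q) = 1 := by
    rcases sign_mul_neg_one_pow hσ q with h | h <;> rw [h] <;> norm_num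
  rw [nodalProfile_eq hk hσ hq (Ioo_subset_Icc_self hx), ← mul_assoc, hs, one_mul]
  have := mul_pos (sub_pos.2 hx.1) (sub_pos.2 hx.2)
  positivity

theorem hasNodalPattern_nodalProfile (hk : 1 ≤ k) (hσ : σ = 1 ∨ σ = -1) :
    HasNodalPattern σ k (nodalProfile σ k) := by
  have hk0 : (0 : ℝ) < k := by positivity
  refine ⟨fun q => q / k, by simp, div_self hk0.ne', fun q _ => ?_,
    fun q hq => (nodal_node hk hσ hq).2, fun q hq y hy => ?_⟩
  · push_cast
    gcongr
    linarith
  · push_cast at hy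
    exact nodalProfile_pos hk hσ hq hy

theorem isWeakDeriv_nodalProfile (hσ : σ = 1 ∨ σ = -1) :
    IsWeakDeriv (nodalProfile σ k) (nodalSlope σ k) :=
  isWeakDeriv_of_primitive (c := 0) (memLp_of_continuousOn (continuousOn_nodalSlope hσ))
    fun _ _ => (zero_add _).symm

theorem memH10_nodalProfile (hk : 1 ≤ k) (hσ : σ = 1 ∨ σ = -1) :
    MemH10 (nodalProfile σ k) := by
  have hk0 : (k : ℝ) ≠ 0 := by positivity
  have hc : ContinuousOn (nodalProfile σ k) (Icc 0 1) := continuousOn_primitive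
    (memLp_of_continuousOn (continuousOn_nodalSlope hσ)).integrable_volΩ
  refine ⟨⟨memLp_of_continuousOn hc, _, isWeakDeriv_nodalProfile hσ⟩, hc, by simp [nodalProfile],
    ?_⟩
  have := (nodal_node hk hσ le_rfl).2
  rwa [div_self hk0] at this

theorem isFixedPointHeaviside_nodalProfile (hk : 1 ≤ k) (hσ : σ = 1 ∨ σ = -1) :
    IsFixedPointHeaviside (nodalProfile σ k) := by
  have hv := isWeakDeriv_nodalProfile (k := k) hσ
  have hpeq := hv.weakDeriv_ae_eq
  have hg := memLp_nodalSign (k := k) hσ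
  have hp : IsWeakDeriv (nodalSlope σ k) (fun x => -nodalSign σ k x) :=
    isWeakDeriv_of_primitive (c := σ * (1 / (2 * k))) hg.neg fun x _ => by
      rw [nodalSlope, intervalIntegral.integral_neg, sub_eq_add_neg]
  have hw := hp.congr_left hpeq.symm
  have hm := memH10_nodalProfile hk hσ
  refine ⟨⟨hm.1, (memLp_congr_ae hpeq).2 hv.1, _, hw⟩, hm, _, hg, ?_, ?_⟩
  · filter_upwards [ae_restrict_mem measurableSet_Ioo] with x hx
    obtain ⟨q, hq, hxq⟩ := exists_cell hk (Ioo_subset_Ico_self hx)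
    have hs := sign_mul_neg_one_pow hσ q
    rw [nodalSign_eq hk hxq]
    -- At a node the profile is zero, where the multivalued function admits either sign.
    rcases hxq.1.eq_or_lt with he | hlt
    · have h0 : nodalProfile σ k x = 0 := he ▸ (nodal_node hk hσ hq.le).2
      rw [h0]
      refine ⟨fun h => absurd h (lt_irrefl _), fun _ => ?_, fun h => absurd h (lt_irrefl _)⟩
      rcases hs with h | h <;> rw [h] <;> norm_num
    · have h0 := nodalProfile_pos hk hσ hq ⟨hlt, hxq.2⟩
      rcases hs with h | h <;> rw [h] at h0 ⊢ <;>
        exact ⟨fun h' => by linarith, fun h' => by linarith, fun h' => by linarith⟩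
  · filter_upwards [hw.weakDeriv_ae_eq] with x hx
    rw [hx, neg_neg]

/-- The sign pattern determines `g` almost everywhere on each cell, so `v` is piecewise parabolic,
and only the nodes remain to be found. -/
theorem eqOn_nodalProfile (hk : 1 ≤ k) (hσ : σ = 1 ∨ σ = -1) {v : ℝ → ℝ}
    (hv : IsFixedPointHeaviside v) (hn : HasNodalPattern σ k v) :
    EqOn v (nodalProfile σ k) (Icc 0 1) := by
  obtain ⟨hH2, hH10, g, hg, hgv, hgd⟩ := hv
  obtain ⟨x, hx0, hxk, hlt, hz, hpos⟩ := hn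
  have hk0 : (0 : ℝ) < k := by positivity
  have hvd := isWeakDeriv_weakDeriv hH10.1.2
  have hgd' : weakDeriv (weakDeriv v) =ᵐ[volΩ] fun t => -g t := by
    filter_upwards [hgd] with t ht
    rw [← ht, neg_neg]
  have hpd := (isWeakDeriv_weakDeriv hH2.2.2).congr_right hgd'
  obtain ⟨c, hc⟩ := hpd.exists_ae_eq_primitive hH2.2.1
  set p : ℝ → ℝ := fun y => c + ∫ t in (0 : ℝ)..y, -g t with hpdef
  have hp := hvd.congr_right hc
  have hvp := hH10.eq_primitive hp
  have hpg : ∀ y ∈ Icc (0 : ℝ) 1, p y = c - ∫ t in (0 : ℝ)..y, g t := fun y _ => by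
    rw [hpdef]
    simp only [intervalIntegral.integral_neg, sub_eq_add_neg]
  have hmem : ∀ q ≤ k, x q ∈ Icc (0 : ℝ) 1 := fun q hq => nodes_mem_Icc hx0 hxk hlt hq
  have hcell : ∀ q < k, ∀ y ∈ Icc (x q) (x (q + 1)),
      p y = p (x q) - σ * (-1) ^ q * (y - x q) ∧
      v y = v (x q) + p (x q) * (y - x q) - σ * (-1) ^ q * (y - x q) ^ 2 / 2 := by
    intro q hq y hy
    refine parabola_of_ae_eq hg.integrable_volΩ hpg hvp (hmem q hq.le).1 (hmem (q + 1) hq).2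
      ?_ hy
    filter_upwards [hgv] with t ht ht'
    have h0 := hpos q hq t ht'
    rcases sign_mul_neg_one_pow hσ q with h | h <;> rw [h] at h0 ⊢
    · exact ht.2.2 (by linarith)
    · exact ht.1 (by linarith)
  have hslope : ∀ q < k, p (x q) = σ * (-1) ^ q * ((x (q + 1) - x q) / 2) := by
    intro q hq
    have h1 := (hcell q hq _ (right_mem_Icc.2 (hlt q hq).le)).2
    rw [hz q hq.le, hz (q + 1) hq] at h1
    have h2 : (x (q + 1) - x q) * (p (x q) - σ * (-1) ^ q * ((x (q + 1) - x q) / 2)) = 0 := by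
      linarith
    have := (mul_eq_zero.1 h2).resolve_left (sub_pos.2 (hlt q hq)).ne'
    linarith
  -- The slope at the common node, computed from the left and from the right cell, is half of either
  -- length up to the same sign.
  have hlen : ∀ q, q + 1 < k → x (q + 1 + 1) - x (q + 1) = x (q + 1) - x q := by
    intro q hq
    have h1 := (hcell q (by omega) _ (right_mem_Icc.2 (hlt q (by omega)).le)).1
    rw [hslope q (by omega), hslope (q + 1) hq, pow_succ] at h1
    rcases sign_mul_neg_one_pow hσ q with h | h
    · have h' : σ * ((-1) ^ q * -1) = -1 := by linarith
      rw [h, h'] at h1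
      linarith
    · have h' : σ * ((-1) ^ q * -1) = 1 := by linarith
      rw [h, h'] at h1
      linarith
  have hlen' : ∀ q < k, x (q + 1) - x q = x 1 := by
    intro q
    induction q with
    | zero => intro _; simp [hx0]
    | succ n ih => intro hn; rw [hlen n hn, ih (by omega)]
  have hnode : ∀ q ≤ k, x q = q * x 1 := by
    intro q
    induction q with
    | zero => intro _; simp [hx0]
    | succ n ih =>
      intro hn
      have := hlen' n hn
      rw [ih (by omega)] at this
      push_cast
      linarith
  have hx1 : x 1 = 1 / k := by
    have := hnode k le_rfl
    rw [hxk] at this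
    field_simp
    linarith
  have hnode' : ∀ q ≤ k, x q = q / k := fun q hq => by
    rw [hnode q hq, hx1, mul_one_div]
  intro y hy
  rcases hy.2.eq_or_lt with rfl | hy1
  · rw [hH10.2.2.2, (memH10_nodalProfile hk hσ).2.2.2]
  · obtain ⟨q, hq, hyq⟩ := exists_cell hk ⟨hy.1, hy1⟩
    have hyq' := Ico_subset_Icc_self hyq
    have hq1 : x (q + 1) = (q + 1) / k := by
      rw [hnode' (q + 1) hq]
      push_cast
      rfl
    have h1 := (hcell q hq y (by rwa [hnode' q hq.le, hq1])).2
    rw [nodalProfile_eq hk hσ hq hyq', h1, hz q hq.le, hslope q hq, hnode' q hq.le, hq1]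
    ring

/-- A slope vanishing almost everywhere would make the profile zero at `1 / (2 * k)`, the midpoint
of the first cell. -/
theorem integral_nodalSlope_sq_pos (hk : 1 ≤ k) (hσ : σ = 1 ∨ σ = -1) :
    0 < ∫ x, nodalSlope σ k x ^ 2 ∂volΩ := by
  have hk0 : (0 : ℝ) < k := by positivity
  have hp := memLp_of_continuousOn (continuousOn_nodalSlope (k := k) hσ)
  refine (integral_nonneg fun x => sq_nonneg _).lt_of_ne' fun h0 => ?_
  rw [integral_eq_zero_iff_of_nonneg (fun x => sq_nonneg _) hp.integrable_sq] at h0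
  have h1 : nodalSlope σ k =ᵐ[volΩ] fun _ => 0 := by
    filter_upwards [h0] with x hx
    simpa using hx
  have hk1 : (1 : ℝ) ≤ k := by exact_mod_cast hk
  have hx : 1 / (2 * (k : ℝ)) ∈ Icc (0 : ℝ) 1 :=
    ⟨by positivity, by rw [div_le_one (by positivity)]; linarith⟩
  have h2 : nodalProfile σ k (1 / (2 * k)) = 0 := by
    rw [nodalProfile, primitive_congr h1 hx]
    simp
  have h3 := nodalProfile_pos hk hσ (q := 0) hk (x := 1 / (2 * k))
    ⟨by simp only [Nat.cast_zero, zero_div]; positivity, by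
      rw [Nat.cast_zero, zero_add]
      exact one_div_lt_one_div_of_lt hk0 (by linarith)⟩
  rw [h2, mul_zero] at h3
  exact lt_irrefl _ h3

end Profile

/-! ### Convergence in the norm of `H¹₀` -/

theorem mainTheorem6 (f : ℝ → ℝ → ℝ) (hf : IsApproxFamily f)
    (ε : ℕ → ℝ) (hε : ∀ m, ε m ∈ Ioc (0 : ℝ) 1) (hε0 : Tendsto ε atTop (𝓝 0))
    (k : ℕ) (hk : 1 ≤ k) (σ : ℝ) (hσ : σ = 1 ∨ σ = -1) :
    ∃ v : ℝ → ℝ,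
      (IsFixedPointHeaviside v ∧ HasNodalPattern σ k v) ∧
      (∀ v' : ℝ → ℝ, IsFixedPointHeaviside v' → HasNodalPattern σ k v' →
        EqOn v' v (Icc 0 1)) ∧
      ∀ w : ℕ → ℝ → ℝ,
        (∀ᶠ m in atTop, IsFixedPointODE (f (ε m)) (w m) ∧ HasNodalPattern σ k (w m)) →
        ¬ Tendsto (fun m => normH10 (w m)) atTop (𝓝 0) ∧
        Tendsto (fun m => normH10 (w m - v)) atTop (𝓝 0) := by
  refine ⟨nodalProfile σ k, ⟨isFixedPointHeaviside_nodalProfile hk hσ,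
    hasNodalPattern_nodalProfile hk hσ⟩, fun v' h1 h2 => eqOn_nodalProfile hk hσ h1 h2,
    fun w hw => ?_⟩
  -- The `w m` are fixed points only for large `m`; stating the estimate as an implication allows
  -- choosing data for every `m`, with zeros as dummies elsewhere.
  have hex : ∀ m, ∃ p P x, (IsFixedPointODE (f (ε m)) (w m) ∧ HasNodalPattern σ k (w m)) →
      NodalEstimate (ε m) σ k (w m) p P x := by
    intro m
    by_cases hm : IsFixedPointODE (f (ε m)) (w m) ∧ HasNodalPattern σ k (w m)
    · obtain ⟨p, P, x, h⟩ := exists_nodalEstimate hf (hε m) hk hσ hm.1 hm.2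
      exact ⟨p, P, x, fun _ => h⟩
    · exact ⟨0, 0, 0, fun h => absurd h hm⟩
  choose p P x hpPx using hex
  have h : ∀ᶠ m in atTop, NodalEstimate (ε m) σ k (w m) (p m) (P m) (x m) :=
    hw.mono fun m hm => hpPx m hm
  have herr := NodalEstimate.tendsto_error hε hε0 hk h
  have hP := NodalEstimate.tendsto_slope hk h herr
  set p₀ := nodalSlope σ k with hp₀
  have hv := isWeakDeriv_nodalProfile (k := k) hσ
  have hp₀c := continuousOn_nodalSlope (k := k) hσ
  have hk0 : (0 : ℝ) < k := by positivity
  have hlim : ∀ᵐ y ∂volΩ, Tendsto (fun m => p m y) atTop (𝓝 (p₀ y)) := by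
    -- Pointwise convergence is established only inside the limiting cells; the grid is countable,
    -- hence null.
    have hgrid : ∀ᵐ y ∂volΩ, y ∉ range fun q : ℕ => (q / k : ℝ) :=
      (countable_range _).ae_notMem _
    filter_upwards [hgrid, ae_restrict_mem measurableSet_Ioo] with y hy hy'
    obtain ⟨q, hq, hyq⟩ := exists_cell hk (Ioo_subset_Ico_self hy')
    rw [hp₀, nodalSlope_eq hk hσ hq (Ico_subset_Icc_self hyq)]
    exact NodalEstimate.tendsto_deriv h herr hP hσ hq
      ⟨hyq.1.lt_of_ne fun he => hy ⟨q, he⟩, hyq.2⟩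
  obtain ⟨C, hC⟩ := isCompact_Icc.exists_bound_of_continuousOn hp₀c
  have hbound : ∀ᶠ m in atTop, ∀ y ∈ Ioo (0 : ℝ) 1, |p m y| ≤ 1 / (2 * k) + 2 := by
    filter_upwards [h, hP.eventually (gt_mem_nhds (lt_add_one _))] with m hm hPm y hy
    linarith [hm.abs_le y (Ioo_subset_Icc_self hy)]
  have hconv1 : Tendsto (fun m => ∫ y, p m y ^ 2 ∂volΩ) atTop (𝓝 (∫ y, p₀ y ^ 2 ∂volΩ)) := by
    refine tendsto_integral_filter_of_dominated_convergence
      (fun _ => (1 / (2 * (k : ℝ)) + 2) ^ 2) ?_ ?_ (integrable_const _) ?_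
    · filter_upwards [h] with m hm
      exact hm.isWeakDeriv.1.aestronglyMeasurable.pow 2
    · filter_upwards [hbound] with m hm
      filter_upwards [ae_restrict_mem measurableSet_Ioo] with y hy
      rw [Real.norm_eq_abs, abs_pow]
      have := hm y hy
      gcongr
    · filter_upwards [hlim] with y hy
      exact hy.pow 2
  have hconv2 : Tendsto (fun m => ∫ y, (p m y - p₀ y) ^ 2 ∂volΩ) atTop (𝓝 0) := by
    have : Tendsto (fun m => ∫ y, (p m y - p₀ y) ^ 2 ∂volΩ) atTop (𝓝 (∫ _, (0 : ℝ) ∂volΩ)) := by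
      refine tendsto_integral_filter_of_dominated_convergence
        (fun _ => (1 / (2 * (k : ℝ)) + 2 + C) ^ 2) ?_ ?_ (integrable_const _) ?_
      · filter_upwards [h] with m hm
        exact (hm.isWeakDeriv.1.sub hv.1).aestronglyMeasurable.pow 2
      · filter_upwards [hbound] with m hm
        filter_upwards [ae_restrict_mem measurableSet_Ioo] with y hy
        rw [Real.norm_eq_abs, abs_pow]
        have h1 := hm y hy
        have h2 := hC y (Ioo_subset_Icc_self hy)
        rw [Real.norm_eq_abs] at h2
        have h3 := (abs_sub (p m y) (p₀ y)).trans (add_le_add h1 h2)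
        gcongr
      · filter_upwards [hlim] with y hy
        simpa using (hy.sub_const (p₀ y)).pow 2
    simpa using this
  constructor
  · intro h0
    have h1 : Tendsto (fun m => normH10 (w m)) atTop
        (𝓝 (Real.sqrt (∫ y, p₀ y ^ 2 ∂volΩ))) := by
      refine hconv1.sqrt.congr' ?_
      filter_upwards [h] with m hm
      rw [normH10_eq hm.isWeakDeriv]
    -- The norms converge to the norm of the profile, which is positive, so they cannot also tend to
    -- zero.
    exact (Real.sqrt_pos.2 (integral_nodalSlope_sq_pos hk hσ)).ne' (tendsto_nhds_unique h1 h0)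
  · have h1 := hconv2.sqrt
    rw [Real.sqrt_zero] at h1
    refine h1.congr' ?_
    filter_upwards [h] with m hm
    rw [normH10_eq (IsWeakDeriv.sub hm.memLp (memH10_nodalProfile hk hσ).1.1 hm.isWeakDeriv hv)]
    rfl
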